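/- **Notation.** Let $n\ge 1$, $1\le j\le n$, $m\in\mathbb N^n$ (with $0\in\mathbb N$) and $1\le p<\infty$. *Laguerre side.* For $k,a\in\mathbb N$ let $\varphi_k^a(r)=L_k^a(r^2/2)\,e^{-r^2/4}$, with $L_k^a$ the Laguerre polynomial of type $a$. On $\mathbb R_+^n$ let $d\mu_m(r)=\prod_{i=1}^n r_i^{2m_i+1}\,dr_i$ and, for $\alpha\in\mathbb N^n$, $$\Psi_\alpha^m(r)=\Big(\frac{2^{-|m|}\,\alpha!}{(\alpha+m)!}\Big)^{1/2}\prod_{i=1}^n\varphi_{\alpha_i}^{m_i}(r_i),$$ an orthonormal system in $L^2(\mathbb R_+^n,d\mu_m)$. The Laguerre Riesz transform of type $m$ is defined for $f\in L^2(\mathbb R_+^n,d\mu_m)$ by the $L^2$-convergent series $$R_{j,m}f(r)=r_j\sum_{\alpha\in\mathbb N^n}(2\alpha_j)^{1/2}(2|\alpha|+n)^{-1/2}\,(f,\Psi_\alpha^m)_{L^2(d\mu_m)}\,\Psi_{\alpha-e_j}^{m+e_j}(r)$$ (terms with $\alpha_j=0$ are zero). It is called bounded on $L^p(\mathbb R_+^n,d\mu_m)$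 if there is a bounded linear operator on $L^p(\mathbb R_+^n,d\mu_m)$ that agrees with $R_{j,m}$ on $L^2\cap L^p$. *Special Hermite side.* On $\mathbb C^n$, $z=x+iy$, let $Z_j=\partial_{x_j}-i\partial_{y_j}-\tfrac12\bar z_j$, $\overline Z_j=\partial_{x_j}+i\partial_{y_j}+\tfrac12 z_j$, and let $L=-\tfrac12\sum_j(Z_j\overline Z_j+\overline Z_jZ_j)$ be the special Hermite operator. With $h_k$ the $L^2(\mathbb R)$-normalized Hermite functions, the special Hermite functions $$\Phi_{\alpha,\beta}(z)=\prod_{i=1}^n(2\pi)^{-1/2}\int_{\mathbb R}e^{ix_i\xi}\,h_{\alpha_i}\big(\xi+\tfrac{y_i}2\big)\,h_{\beta_i}\big(\xi-\tfrac{y_i}2\big)\,d\xi$$ form an orthonormal basis of $L^2(\mathbb C^n)$ with $L\Phi_{\alpha,\beta}=(2|\alpha|+n)\Phi_{\alpha,\beta}$, so that $L^{-1/2}g=\sum_{\alpha,\beta}(2|\alpha|+n)^{-1/2}(g,\Phi_{\alpha,\beta})\Phi_{\alpha,\beta}$ for $g\in L^2(\mathbb C^n)$. The special Hermite Riesz transform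 is $T_{\bar z_j}=\overline Z_jL^{-1/2}$ on $L^2(\mathbb C^n)$, with $\overline Z_j$ taken in the sense of distributions. A function $f$ on $\mathbb C^n$ is polyradial if $f(\sigma z)=f(z)$ for all diagonal unitary matrices $\sigma$, and $g$ is $m$-homogeneous if $g(z)=z^mf(z)$ with $f$ polyradial. **Theorem.** The Laguerre Riesz transform $R_{j,m}$ is bounded on $L^p(\mathbb R_+^n,d\mu_m)$ if and only if there is a constant $C$ such that $$\int_{\mathbb C^n}|T_{\bar z_j}g(z)|^p\prod_{i=1}^n|z_i|^{m_i(2-p)}\,dz\le C\int_{\mathbb C^n}|g(z)|^p\prod_{i=1}^n|z_i|^{m_i(2-p)}\,dz$$ for all $m$-homogeneous functions $g\in L^2(\mathbb C^n)$. -/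

import Mathlib

open MeasureTheory Polynomial
open scoped ENNReal NNReal ContDiff

noncomputable section

namespace LaguerreRiesz

/-! ### Integrability of polynomials times Gaussians -/

theorem integrable_poly_gauss (Q : ℂ[X]) {b : ℝ} (hb : 0 < b) :
    Integrable (fun x : ℝ => Q.eval (x : ℂ) * ((Real.exp (-b * x ^ 2) : ℝ) : ℂ)) := by
  induction Q using Polynomial.induction_on' with
  | add p q hp hq =>
    refine (hp.add hq).congr (Filter.Eventually.of_forall fun x => ?_)
    simp [add_mul]
  | monomial k c =>
    have h := (integrable_rpow_mul_exp_neg_mul_sq hb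
      (s := (k : ℝ)) (by have : (0 : ℝ) ≤ k := k.cast_nonneg; linarith)).ofReal (𝕜 := ℂ)
    have h2 := h.const_mul c
    refine h2.congr (Filter.Eventually.of_forall fun x => ?_)
    simp [Real.rpow_natCast, mul_assoc]

theorem memLp_poly_gauss (Q : ℂ[X]) {b : ℝ} (hb : 0 < b) :
    MemLp (fun x : ℝ => Q.eval (x : ℂ) * ((Real.exp (-b * x ^ 2) : ℝ) : ℂ)) 2 := by
  have hc : Continuous (fun x : ℝ => Q.eval (x : ℂ) * ((Real.exp (-b * x ^ 2) : ℝ) : ℂ)) := by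
    fun_prop
  rw [memLp_two_iff_integrable_sq_norm hc.aestronglyMeasurable]
  have h := (integrable_poly_gauss (Q * Q) (b := 2 * b) (by linarith)).norm
  refine h.congr (Filter.Eventually.of_forall fun x => ?_)
  simp only [norm_mul, eval_mul, Complex.norm_real, Real.norm_eq_abs, Real.abs_exp]
  have : Real.exp (-(2 * b) * x ^ 2) = Real.exp (-b * x ^ 2) ^ 2 := by
    rw [← Real.exp_nat_mul]; congr 1; push_cast; ring
  rw [this]; ring

/-! ### Laguerre functions and the Laguerre Riesz transforms -/

/-- The Laguerre polynomial `L_k^a` of type `a ∈ ℕ`. -/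
def laguerrePoly (k a : ℕ) : ℝ[X] :=
  ∑ i ∈ Finset.range (k + 1),
    C ((-1) ^ i * ((k + a).choose (k - i) : ℝ) / (i.factorial : ℝ)) * X ^ i

/-- The Laguerre function `φ_k^a(r) = L_k^a(r²/2) e^{-r²/4}`. -/
def laguerreFun (k a : ℕ) (r : ℝ) : ℝ :=
  (laguerrePoly k a).eval (r ^ 2 / 2) * Real.exp (-(r ^ 2) / 4)

/-- The measure `r^{2a+1} dr` on `(0, ∞)`, as a measure on `ℝ`. -/
def radialMeasure (a : ℕ) : Measure ℝ :=
  (volume.restrict (Set.Ioi 0)).withDensity fun r => ENNReal.ofReal (r ^ (2 * a + 1))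

instance (a : ℕ) : SigmaFinite (radialMeasure a) := by
  unfold radialMeasure; infer_instance

/-- The measure `dμ_m(r) = ∏ r_j^{2m_j+1} dr_j` on `ℝ_+^n`, as a measure on `ℝ^n`. -/
def muMeasure {n : ℕ} (m : Fin n → ℕ) : Measure (Fin n → ℝ) :=
  Measure.pi fun j => radialMeasure (m j)

/-- The multiple Laguerre function of type `m`,
`Ψ_α^m(r) = (2^{-|m|} α! / (α+m)!)^{1/2} ∏ φ_{α_j}^{m_j}(r_j)`. -/
def Psi {n : ℕ} (m α : Fin n → ℕ) (r : Fin n → ℝ) : ℂ :=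
  ((∏ j, Real.sqrt ((α j).factorial / (2 ^ m j * (α j + m j).factorial)) *
    laguerreFun (α j) (m j) (r j) : ℝ) : ℂ)

theorem memLp_radial (a : ℕ) (Q : ℂ[X]) :
    MemLp (fun r : ℝ => Q.eval (r : ℂ) * ((Real.exp (-(1 / 4) * r ^ 2) : ℝ) : ℂ)) 2
      (radialMeasure a) := by
  have hc : Continuous
      (fun r : ℝ => Q.eval (r : ℂ) * ((Real.exp (-(1 / 4) * r ^ 2) : ℝ) : ℂ)) := by
    fun_prop
  rw [memLp_two_iff_integrable_sq_norm hc.aestronglyMeasurable, radialMeasure,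
    integrable_withDensity_iff (by fun_prop) (by simp)]
  have h := (integrable_poly_gauss (Q * Q * X ^ (2 * a + 1)) (b := 1 / 2) (by norm_num)).norm
  refine (h.mono_measure Measure.restrict_le_self).congr ?_
  filter_upwards [ae_restrict_mem measurableSet_Ioi] with r hr
  have hr' : (0 : ℝ) < r := hr
  have : Real.exp (-(1 / 2) * r ^ 2) = Real.exp (-(1 / 4) * r ^ 2) ^ 2 := by
    rw [← Real.exp_nat_mul]; congr 1; push_cast; ring
  simp only [norm_mul, eval_mul, eval_pow, eval_X, norm_pow, Complex.norm_real,
    Real.norm_eq_abs, Real.abs_exp]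
  rw [this, ENNReal.toReal_ofReal (by positivity), abs_of_pos hr']
  ring

theorem memLp_pi_prod {n : ℕ} {E : Type*} [MeasurableSpace E] (ν : Fin n → Measure E)
    [∀ i, SigmaFinite (ν i)] (f : Fin n → E → ℂ) (hf : ∀ i, MemLp (f i) 2 (ν i)) :
    MemLp (fun x : Fin n → E => ∏ i, f i (x i)) 2 (Measure.pi ν) := by
  have hm : AEStronglyMeasurable (fun x : Fin n → E => ∏ i, f i (x i)) (Measure.pi ν) := by
    refine Finset.aestronglyMeasurable_fun_prod _ fun i _ => ?_
    exact (hf i).1.comp_quasiMeasurePreserving (Measure.quasiMeasurePreserving_eval _ i)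
  rw [memLp_two_iff_integrable_sq_norm hm]
  have h := Integrable.fintype_prod (μ := ν) (f := fun i x => ‖f i x‖ ^ 2)
    (fun i => (memLp_two_iff_integrable_sq_norm (hf i).1).1 (hf i))
  refine h.congr (Filter.Eventually.of_forall fun x => ?_)
  simp [norm_prod, Finset.prod_pow]

theorem memLp_laguerreFun (c : ℝ) (k a b : ℕ) (Q : ℂ[X]) :
    MemLp (fun r : ℝ => Q.eval (r : ℂ) * ((c * laguerreFun k a r : ℝ) : ℂ)) 2
      (radialMeasure b) := by
  refine (memLp_radial b (Q * C (c : ℂ) *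
    ((laguerrePoly k a).map Complex.ofRealHom).comp (C (1 / 2) * X ^ 2))).ae_eq
    (Filter.Eventually.of_forall fun r => ?_)
  have h : ((laguerrePoly k a).map Complex.ofRealHom).eval (1 / 2 * (r : ℂ) ^ 2)
      = (((laguerrePoly k a).eval (r ^ 2 / 2) : ℝ) : ℂ) := by
    have := Polynomial.eval_map_apply (f := Complex.ofRealHom) (p := laguerrePoly k a) (r ^ 2 / 2)
    rw [Complex.ofRealHom_eq_coe, Complex.ofRealHom_eq_coe] at this
    rw [← this]
    congr 1
    push_cast; ring
  simp only [eval_mul, eval_comp, eval_C, eval_pow, eval_X, h, laguerreFun]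
  push_cast
  rw [show -(1 / 4 : ℂ) * (r : ℂ) ^ 2 = -(r : ℂ) ^ 2 / 4 by ring]
  ring

theorem memLp_Psi {n : ℕ} (m α : Fin n → ℕ) : MemLp (Psi m α) 2 (muMeasure m) := by
  have h := memLp_pi_prod (fun j => radialMeasure (m j)) _
    (fun j => memLp_laguerreFun
      (Real.sqrt ((α j).factorial / (2 ^ m j * (α j + m j).factorial))) (α j) (m j) (m j) 1)
  refine h.ae_eq (Filter.Eventually.of_forall fun r => ?_)
  simp [Psi]

theorem memLp_coord_mul_Psi {n : ℕ} (j : Fin n) (m m' α : Fin n → ℕ) :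
    MemLp (fun r : Fin n → ℝ => (r j : ℂ) * Psi m' α r) 2 (muMeasure m) := by
  have h := memLp_pi_prod (fun j => radialMeasure (m j)) _
    (fun i => memLp_laguerreFun
      (Real.sqrt ((α i).factorial / (2 ^ m' i * (α i + m' i).factorial))) (α i) (m' i) (m i)
      (if i = j then X else 1))
  refine h.ae_eq (Filter.Eventually.of_forall fun r => ?_)
  have h2 : ∏ i, (if i = j then (X : ℂ[X]) else 1).eval (r i : ℂ) = (r j : ℂ) := by
    rw [Finset.prod_eq_single j] <;> simp +contextual
  simp only [Psi, Finset.prod_mul_distrib, h2, Complex.ofReal_prod, Complex.ofReal_mul]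

/-- `Ψ_α^m` as an element of `L²(ℝ_+^n, dμ_m)`. -/
def PsiLp {n : ℕ} (m α : Fin n → ℕ) : Lp ℂ 2 (muMeasure m) := (memLp_Psi m α).toLp

/-- The function `r_j Ψ_{α-e_j}^{m+e_j}(r)` as an element of `L²(ℝ_+^n, dμ_m)`. (For `α_j = 0`
the subtraction is truncated, but then its coefficient in the Riesz transform vanishes.) -/
def PsiShiftLp {n : ℕ} (j : Fin n) (m α : Fin n → ℕ) : Lp ℂ 2 (muMeasure m) :=
  (memLp_coord_mul_Psi j m (m + Pi.single j 1) (α - Pi.single j 1)).toLp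

/-- The Riesz transform for Laguerre expansions of type `m`,
`R_{j,m} f = r_j ∑_α (2α_j)^{1/2} (2|α|+n)^{-1/2} (f, Ψ_α^m) Ψ_{α-e_j}^{m+e_j}`,
the (orthogonal) series converging in `L²(ℝ_+^n, dμ_m)`. -/
def laguerreRiesz {n : ℕ} (j : Fin n) (m : Fin n → ℕ) (f : Lp ℂ 2 (muMeasure m)) :
    Lp ℂ 2 (muMeasure m) :=
  ∑' α : Fin n → ℕ,
    (((Real.sqrt (2 * α j) / Real.sqrt (2 * ((∑ i, α i : ℕ) : ℝ) + n) : ℝ) : ℂ) *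
      inner ℂ (PsiLp m α) f) • PsiShiftLp j m α

/-- `R_{j,m}`, initially defined on `L²(dμ_m)`, is bounded on `L^p(ℝ_+^n, dμ_m)`: there is a
bounded operator on `L^p(dμ_m)` that agrees with it on `L² ∩ L^p`. -/
def LaguerreRieszBounded {n : ℕ} (p : ℝ≥0∞) [Fact (1 ≤ p)] (j : Fin n) (m : Fin n → ℕ) : Prop :=
  ∃ S : Lp ℂ p (muMeasure m) →L[ℂ] Lp ℂ p (muMeasure m),
    ∀ (f : Lp ℂ 2 (muMeasure m)) (hf : MemLp f p (muMeasure m)),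
      S hf.toLp =ᵐ[muMeasure m] laguerreRiesz j m f

/-! ### Special Hermite functions and the special Hermite Riesz transforms -/

/-- The `L²`-normalized Hermite function
`h_k(s) = (2^k k! √π)^{-1/2} H_k(s) e^{-s²/2}`; the physicists' Hermite polynomial is
`H_k(s) = 2^{k/2} He_k(√2 s)`, where `He_k` is Mathlib's `Polynomial.hermite k`. -/
def hermiteFun (k : ℕ) (s : ℝ) : ℝ :=
  (Real.sqrt (k.factorial * Real.sqrt Real.pi))⁻¹ *
    aeval (Real.sqrt 2 * s) (hermite k) * Real.exp (-(s ^ 2) / 2)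

/-- The special Hermite function on `ℂ`,
`Φ_{k,l}(x+iy) = (2π)^{-1/2} ∫ e^{ixξ} h_k(ξ+y/2) h_l(ξ-y/2) dξ = (2π)^{-1/2} (π(z)h_k, h_l)`,
with `π(z)` the Schrödinger representation (with parameter 1). -/
def specialHermite₁ (k l : ℕ) (z : ℂ) : ℂ :=
  ((Real.sqrt (2 * Real.pi))⁻¹ : ℝ) *
    ∫ ξ : ℝ, Complex.exp (Complex.I * z.re * ξ) *
      ((hermiteFun k (ξ + z.im / 2) * hermiteFun l (ξ - z.im / 2) : ℝ) : ℂ)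

/-- The special Hermite function `Φ_{α,β}(z) = ∏_j Φ_{α_j,β_j}(z_j)` on `ℂ^n`. -/
def specialHermite {n : ℕ} (α β : Fin n → ℕ) (z : Fin n → ℂ) : ℂ :=
  ∏ j, specialHermite₁ (α j) (β j) (z j)

theorem integrable_fourier_gauss (Q : ℂ[X]) (x : ℝ) :
    Integrable (fun ξ : ℝ => Complex.exp (Complex.I * x * ξ) *
      (Q.eval (ξ : ℂ) * ((Real.exp (-1 * ξ ^ 2) : ℝ) : ℂ))) := by
  refine (integrable_poly_gauss Q one_pos).bdd_mul (c := 1)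
    (Continuous.aestronglyMeasurable (by fun_prop)) (Filter.Eventually.of_forall fun ξ => ?_)
  rw [show Complex.I * x * ξ = ((x * ξ : ℝ) : ℂ) * Complex.I by push_cast; ring,
    Complex.norm_exp_ofReal_mul_I]

theorem fourier_pow_gauss_succ (a : ℕ) (x : ℝ) :
    ∫ ξ : ℝ, Complex.exp (Complex.I * x * ξ) *
      ((X ^ (a + 1) : ℂ[X]).eval (ξ : ℂ) * ((Real.exp (-1 * ξ ^ 2) : ℝ) : ℂ)) =
    (Complex.I * x / 2) * (∫ ξ : ℝ, Complex.exp (Complex.I * x * ξ) *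
      ((X ^ a : ℂ[X]).eval (ξ : ℂ) * ((Real.exp (-1 * ξ ^ 2) : ℝ) : ℂ))) +
    (a / 2) * (∫ ξ : ℝ, Complex.exp (Complex.I * x * ξ) *
      ((X ^ (a - 1) : ℂ[X]).eval (ξ : ℂ) * ((Real.exp (-1 * ξ ^ 2) : ℝ) : ℂ))) := by
  have hd : ∀ ξ : ℝ, HasDerivAt (fun ξ : ℝ => Complex.exp (Complex.I * x * ξ) *
      ((X ^ a : ℂ[X]).eval (ξ : ℂ) * ((Real.exp (-1 * ξ ^ 2) : ℝ) : ℂ)))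
      ((Complex.I * x) * (Complex.exp (Complex.I * x * ξ) *
      ((X ^ a : ℂ[X]).eval (ξ : ℂ) * ((Real.exp (-1 * ξ ^ 2) : ℝ) : ℂ))) +
      a * (Complex.exp (Complex.I * x * ξ) *
      ((X ^ (a - 1) : ℂ[X]).eval (ξ : ℂ) * ((Real.exp (-1 * ξ ^ 2) : ℝ) : ℂ))) -
      2 * (Complex.exp (Complex.I * x * ξ) *
      ((X ^ (a + 1) : ℂ[X]).eval (ξ : ℂ) * ((Real.exp (-1 * ξ ^ 2) : ℝ) : ℂ)))) ξ := by
    intro ξ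
    have hid : HasDerivAt (fun ξ : ℝ => (ξ : ℂ)) 1 ξ := Complex.ofRealCLM.hasDerivAt
    have h1 := (hid.const_mul (Complex.I * x)).cexp
    have h2 := hid.fun_pow a
    have h3 := ((hid.fun_pow 2).const_mul (-1)).cexp
    have h4 := h1.fun_mul (h2.fun_mul h3)
    simp only [eval_pow, eval_X, Complex.ofReal_exp, Complex.ofReal_mul, Complex.ofReal_pow,
      Complex.ofReal_neg, Complex.ofReal_one]
    refine h4.congr_deriv ?_
    push_cast
    ring
  have h0 := integral_eq_zero_of_hasDerivAt_of_integrable hd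
    ((((integrable_fourier_gauss (X ^ a) x).const_mul _).add
      ((integrable_fourier_gauss (X ^ (a - 1)) x).const_mul _)).sub
      ((integrable_fourier_gauss (X ^ (a + 1)) x).const_mul _))
    (integrable_fourier_gauss (X ^ a) x)
  rw [integral_sub (by
      exact ((integrable_fourier_gauss (X ^ a) x).const_mul _).add
        ((integrable_fourier_gauss (X ^ (a - 1)) x).const_mul _))
      ((integrable_fourier_gauss (X ^ (a + 1)) x).const_mul _),
    integral_add ((integrable_fourier_gauss (X ^ a) x).const_mul _)
      ((integrable_fourier_gauss (X ^ (a - 1)) x).const_mul _),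
    integral_const_mul, integral_const_mul, integral_const_mul] at h0
  linear_combination -(1 / 2) * h0

theorem fourier_pow_gauss (a : ℕ) : ∃ Q : ℂ[X], ∀ x : ℝ,
    ∫ ξ : ℝ, Complex.exp (Complex.I * x * ξ) *
      ((X ^ a : ℂ[X]).eval (ξ : ℂ) * ((Real.exp (-1 * ξ ^ 2) : ℝ) : ℂ)) =
    Q.eval (x : ℂ) * ((Real.exp (-(1 / 4) * x ^ 2) : ℝ) : ℂ) := by
  induction a using Nat.strong_induction_on with
  | _ a ih =>
    rcases a with _ | a
    · refine ⟨C ((Real.pi : ℂ) ^ (1 / 2 : ℂ)), fun x => ?_⟩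
      have h := fourierIntegral_gaussian (b := 1) (by simp) (x : ℂ)
      simp only [pow_zero, eval_one, one_mul, eval_C, Complex.ofReal_exp]
      push_cast
      rw [div_one] at h
      rw [h]
      congr 2
      ring
    · obtain ⟨Q₁, h₁⟩ := ih a (by omega)
      obtain ⟨Q₂, h₂⟩ := ih (a - 1) (by omega)
      refine ⟨C (Complex.I / 2) * X * Q₁ + C (a / 2 : ℂ) * Q₂, fun x => ?_⟩
      rw [fourier_pow_gauss_succ, h₁, h₂]
      simp only [eval_add, eval_mul, eval_C, eval_X]
      ring

theorem memLp_re_im {u v : ℝ → ℂ} (hu : MemLp u 2) (hv : MemLp v 2) :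
    MemLp (fun z : ℂ => u z.re * v z.im) 2 := by
  have h : MemLp (fun q : ℝ × ℝ => u q.1 * v q.2) 2 := by
    have hm : AEStronglyMeasurable (fun q : ℝ × ℝ => u q.1 * v q.2) volume :=
      hu.1.comp_fst.mul hv.1.comp_snd
    rw [memLp_two_iff_integrable_sq_norm hm]
    have h := ((memLp_two_iff_integrable_sq_norm hu.1).1 hu).mul_prod
      ((memLp_two_iff_integrable_sq_norm hv.1).1 hv)
    refine h.congr (Filter.Eventually.of_forall fun q => ?_)
    simp [mul_pow]
  exact h.comp_measurePreserving Complex.volume_preserving_equiv_real_prod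

theorem fourierWigner_poly (R : MvPolynomial (Fin 2) ℝ) :
    (∀ x y : ℝ, Integrable fun ξ : ℝ => Complex.exp (Complex.I * x * ξ) *
      ((MvPolynomial.eval ![ξ, y] R * Real.exp (-1 * ξ ^ 2) * Real.exp (-(1 / 4) * y ^ 2) : ℝ) :
        ℂ)) ∧
    MemLp (fun z : ℂ => ∫ ξ : ℝ, Complex.exp (Complex.I * z.re * ξ) *
      ((MvPolynomial.eval ![ξ, z.im] R * Real.exp (-1 * ξ ^ 2) *
        Real.exp (-(1 / 4) * z.im ^ 2) : ℝ) : ℂ)) 2 := by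
  induction R using MvPolynomial.induction_on' with
  | monomial s c =>
    have key : ∀ x y ξ : ℝ, Complex.exp (Complex.I * x * ξ) *
        ((MvPolynomial.eval ![ξ, y] (MvPolynomial.monomial s c) * Real.exp (-1 * ξ ^ 2) *
          Real.exp (-(1 / 4) * y ^ 2) : ℝ) : ℂ) =
        (Complex.exp (Complex.I * x * ξ) *
          ((X ^ s 0 : ℂ[X]).eval (ξ : ℂ) * ((Real.exp (-1 * ξ ^ 2) : ℝ) : ℂ))) *
        ((C (c : ℂ) * X ^ s 1 : ℂ[X]).eval (y : ℂ) *
          ((Real.exp (-(1 / 4) * y ^ 2) : ℝ) : ℂ)) := by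
      intro x y ξ
      rw [MvPolynomial.eval_monomial, Finsupp.prod_fintype _ _ (by simp), Fin.prod_univ_two]
      simp only [Matrix.cons_val_zero, Matrix.cons_val_one, eval_mul, eval_C, eval_pow, eval_X,
        Complex.ofReal_mul, Complex.ofReal_pow]
      ring
    simp only [key]
    refine ⟨fun x y => (integrable_fourier_gauss _ x).mul_const _, ?_⟩
    obtain ⟨Q, hQ⟩ := fourier_pow_gauss (s 0)
    simp only [integral_mul_const, hQ]
    exact memLp_re_im (memLp_poly_gauss Q (by norm_num)) (memLp_poly_gauss _ (by norm_num))
  | add p q hp hq =>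
    have key : ∀ x y ξ : ℝ, Complex.exp (Complex.I * x * ξ) *
        ((MvPolynomial.eval ![ξ, y] (p + q) * Real.exp (-1 * ξ ^ 2) *
          Real.exp (-(1 / 4) * y ^ 2) : ℝ) : ℂ) =
        Complex.exp (Complex.I * x * ξ) *
        ((MvPolynomial.eval ![ξ, y] p * Real.exp (-1 * ξ ^ 2) *
          Real.exp (-(1 / 4) * y ^ 2) : ℝ) : ℂ) +
        Complex.exp (Complex.I * x * ξ) *
        ((MvPolynomial.eval ![ξ, y] q * Real.exp (-1 * ξ ^ 2) *
          Real.exp (-(1 / 4) * y ^ 2) : ℝ) : ℂ) := by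
      intro x y ξ
      rw [MvPolynomial.eval_add]; push_cast; ring
    simp only [key]
    refine ⟨fun x y => (hp.1 x y).add (hq.1 x y), ?_⟩
    simp only [integral_add (hp.1 _ _) (hq.1 _ _)]
    exact hp.2.add hq.2

theorem memLp_specialHermite₁ (k l : ℕ) : MemLp (specialHermite₁ k l) 2 := by
  let R : MvPolynomial (Fin 2) ℝ :=
    MvPolynomial.C (Real.sqrt (k.factorial * Real.sqrt Real.pi))⁻¹ *
    MvPolynomial.C (Real.sqrt (l.factorial * Real.sqrt Real.pi))⁻¹ *
    aeval (MvPolynomial.C (Real.sqrt 2) *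
      (MvPolynomial.X 0 + MvPolynomial.C (1 / 2) * MvPolynomial.X 1)) (hermite k) *
    aeval (MvPolynomial.C (Real.sqrt 2) *
      (MvPolynomial.X 0 - MvPolynomial.C (1 / 2) * MvPolynomial.X 1)) (hermite l)
  have hR : ∀ ξ y : ℝ, hermiteFun k (ξ + y / 2) * hermiteFun l (ξ - y / 2) =
      MvPolynomial.eval ![ξ, y] R * Real.exp (-1 * ξ ^ 2) * Real.exp (-(1 / 4) * y ^ 2) := by
    intro ξ y
    have he : Real.exp (-((ξ + y / 2) ^ 2) / 2) * Real.exp (-((ξ - y / 2) ^ 2) / 2) =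
        Real.exp (-1 * ξ ^ 2) * Real.exp (-(1 / 4) * y ^ 2) := by
      rw [← Real.exp_add, ← Real.exp_add]; congr 1; ring
    have hv : ∀ (t : MvPolynomial (Fin 2) ℝ) (P : ℤ[X]),
        MvPolynomial.eval ![ξ, y] (aeval t P) = aeval (MvPolynomial.eval ![ξ, y] t) P := by
      intro t P
      exact (Polynomial.aeval_algHom_apply
        ((MvPolynomial.eval ![ξ, y]).toIntAlgHom) t P).symm
    simp only [R, map_mul, hv, MvPolynomial.eval_C, map_add, map_sub, MvPolynomial.eval_X,
      Matrix.cons_val_zero, Matrix.cons_val_one, hermiteFun]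
    rw [show ξ + 1 / 2 * y = ξ + y / 2 by ring, show ξ - 1 / 2 * y = ξ - y / 2 by ring]
    linear_combination ((Real.sqrt (k.factorial * Real.sqrt Real.pi))⁻¹ *
      (Real.sqrt (l.factorial * Real.sqrt Real.pi))⁻¹ *
      aeval (Real.sqrt 2 * (ξ + y / 2)) (hermite k) *
      aeval (Real.sqrt 2 * (ξ - y / 2)) (hermite l)) * he
  have h := (fourierWigner_poly R).2.const_mul (((Real.sqrt (2 * Real.pi))⁻¹ : ℝ) : ℂ)
  refine h.ae_eq (Filter.Eventually.of_forall fun z => ?_)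
  simp only [specialHermite₁, hR]

theorem memLp_specialHermite {n : ℕ} (α β : Fin n → ℕ) : MemLp (specialHermite α β) 2 :=
  memLp_pi_prod (fun _ => (volume : Measure ℂ)) (fun j => specialHermite₁ (α j) (β j))
    (fun j => memLp_specialHermite₁ (α j) (β j))

/-- `Φ_{α,β}` as an element of `L²(ℂ^n)`. -/
def specialHermiteLp {n : ℕ} (α β : Fin n → ℕ) : Lp ℂ 2 (volume : Measure (Fin n → ℂ)) :=
  (memLp_specialHermite α β).toLp

/-- The operator `L^{-1/2}` on `L²(ℂ^n)`. The special Hermite operator is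
`L = -½ ∑_j (Z_j Z̄_j + Z̄_j Z_j)` with `Z_j = ∂_{x_j} - i ∂_{y_j} - z̄_j/2` and
`Z̄_j = ∂_{x_j} + i ∂_{y_j} + z_j/2`. The `Φ_{α,β}` form an orthonormal basis of `L²(ℂ^n)` with
`L Φ_{α,β} = (2|α|+n) Φ_{α,β}`, so the spectral decomposition of `L` gives
`L^{-1/2} g = ∑_{α,β} (2|α|+n)^{-1/2} (g, Φ_{α,β}) Φ_{α,β}`, converging in `L²(ℂ^n)`. -/
def invSqrtL {n : ℕ} (g : Lp ℂ 2 (volume : Measure (Fin n → ℂ))) :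
    Lp ℂ 2 (volume : Measure (Fin n → ℂ)) :=
  ∑' q : (Fin n → ℕ) × (Fin n → ℕ),
    ((((Real.sqrt (2 * ((∑ i, q.1 i : ℕ) : ℝ) + n))⁻¹ : ℝ) : ℂ) *
      inner ℂ (specialHermiteLp q.1 q.2) g) • specialHermiteLp q.1 q.2

/-- `Z̄_j u = v` in the sense of distributions, where `Z̄_j = ∂_{x_j} + i ∂_{y_j} + z_j/2`
(so that the vector field `Z̄_j` of the Heisenberg group maps `e^{it} u(z)` to
`e^{it} Z̄_j u(z)`). -/
def IsZbar {n : ℕ} (j : Fin n) (u v : Lp ℂ 2 (volume : Measure (Fin n → ℂ))) : Prop :=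
  ∀ φ : (Fin n → ℂ) → ℂ, ContDiff ℝ ∞ φ → HasCompactSupport φ →
    ∫ z, v z * φ z =
      ∫ z, u z * (-(fderiv ℝ φ z (Pi.single j 1) +
        Complex.I * fderiv ℝ φ z (Pi.single j Complex.I)) + z j / 2 * φ z)

open Classical in
/-- The operator `Z̄_j` on `L²(ℂ^n)` with its maximal domain
`{u | Z̄_j u ∈ L²(ℂ^n) in the sense of distributions}`; outside this domain the value is `0`.
(The range of `L^{-1/2}` lies in the domain.) -/
def zbar {n : ℕ} (j : Fin n) (u : Lp ℂ 2 (volume : Measure (Fin n → ℂ))) :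
    Lp ℂ 2 (volume : Measure (Fin n → ℂ)) :=
  if h : ∃ v, IsZbar j u v then h.choose else 0

/-- The special Hermite Riesz transform `T_{z̄_j} = Z̄_j L^{-1/2}` on `L²(ℂ^n)`. -/
def specialHermiteRiesz {n : ℕ} (j : Fin n) (g : Lp ℂ 2 (volume : Measure (Fin n → ℂ))) :
    Lp ℂ 2 (volume : Measure (Fin n → ℂ)) :=
  zbar j (invSqrtL g)

/-- `f` is polyradial: invariant under all diagonal unitary matrices. -/
def Polyradial {n : ℕ} (f : (Fin n → ℂ) → ℂ) : Prop :=
  ∀ σ : Fin n → ℂ, (∀ j, ‖σ j‖ = 1) → ∀ z, f (fun j => σ j * z j) = f z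

/-- `g(z) = z^m f(z)` (almost everywhere) with `f` polyradial. -/
def IsHomogeneous {n : ℕ} (m : Fin n → ℕ) (g : (Fin n → ℂ) → ℂ) : Prop :=
  ∃ f : (Fin n → ℂ) → ℂ, Polyradial f ∧ ∀ᵐ z, g z = (∏ j, z j ^ m j) * f z

/-- The weighted integral `∫_{ℂ^n} |g(z)|^p ∏_j |z_j|^{m_j(2-p)} dz ∈ [0, ∞]`. -/
def weightedIntegral {n : ℕ} (p : ℝ) (m : Fin n → ℕ) (g : (Fin n → ℂ) → ℂ) : ℝ≥0∞ :=
  ∫⁻ z, ENNReal.ofReal (‖g z‖ ^ p * ∏ j, ‖z j‖ ^ ((m j : ℝ) * (2 - p)))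

end LaguerreRiesz

end

noncomputable section

namespace LaguerreRiesz

/-! ### Laguerre polynomials -/

/-! The two Riesz transforms are the same operator seen through two isometries. Let `U f (z) =
(2π)^{-n/2} z^m f(|z_1|, …, |z_n|)` (`monomialLift`) and let `V` be `U` followed by multiplication
with the phase `z_j / |z_j|` (`phaseLift`). Polar coordinates show that both embed `L²(dμ_m)`
isometrically in `L²(ℂ^n)`, and the range of `U` is exactly the space of `m`-homogeneous `L²`
functions (`isHomogeneous_monomialLift`, `exists_monomialLift_eq`).

The heart is the intertwining relation `T U = -V R` (`specialHermiteRiesz_monomialLift`), which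
rests on three facts. Up to the unimodular constant `i^{|m|}`, `U` carries `Ψ_α^m` to `Φ_{α,α+m}`
(`specialHermiteLp_eq_lift`). The remaining `Φ_{α,β}` transform under the torus by another
character, hence are orthogonal to the range of `U` (`inner_specialHermiteLp_monomialLift_eq_zero`),
so `L^{-1/2}` acts on that range by the multiplier `(2|α|+n)^{-1/2}`. Finally, `Z̄_j` lowers `α_j`
and raises `m_j`, with factor `-(2α_j)^{1/2}` (`isZbar_monomialLift_PsiLp`). The distributional
`Z̄_j` is single-valued and closed, so these identities may be summed term by term. Completeness of
the two orthonormal systems plays no role, since `R` and `L^{-1/2}` are given by their series.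

Because `U` and `V` have weights of the same modulus and `|z^m|^p |z^m|^{2-p} = |z^m|²`, the
weighted integral of a lift is one fixed positive constant times `∫ |f|^p dμ_m`
(`weightedIntegral_lift`). The weighted inequality for `T` is therefore the `L^p` inequality for `R`
on `L²`, with the same constant. That inequality is equivalent to boundedness on `L^p` by density of
simple functions (`laguerreRieszBounded_iff`). -/

theorem coeff_laguerrePoly (k a i : ℕ) :
    (laguerrePoly k a).coeff i =
      if i ≤ k then (-1) ^ i * ((k + a).choose (k - i) : ℝ) / (i.factorial : ℝ) else 0 := by
  simp only [laguerrePoly, finsetSum_coeff, coeff_C_mul, coeff_X_pow, mul_ite, mul_one, mul_zero,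
    Finset.sum_ite_eq, Finset.mem_range, Nat.lt_succ_iff]

theorem laguerrePoly_zero (a : ℕ) : laguerrePoly 0 a = 1 := by
  simp [laguerrePoly]

theorem derivative_laguerrePoly_succ (k a : ℕ) :
    derivative (laguerrePoly (k + 1) a) = -laguerrePoly k (a + 1) := by
  ext i
  rw [coeff_derivative, coeff_neg, coeff_laguerrePoly, coeff_laguerrePoly]
  by_cases h : i ≤ k
  · rw [if_pos h, if_pos (by omega), show k + 1 + a = k + (a + 1) by ring,
      show k + 1 - (i + 1) = k - i by omega, Nat.factorial_succ]
    have : (i.factorial : ℝ) ≠ 0 := by positivity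
    push_cast
    field_simp
    ring
  · rw [if_neg h, if_neg (by omega)]; simp

theorem laguerrePoly_succ (k a : ℕ) :
    C (k + 1 : ℝ) * laguerrePoly (k + 1) a =
      C (k + 1 + a : ℝ) * laguerrePoly k a - X * laguerrePoly k (a + 1) := by
  ext i
  rw [coeff_sub, coeff_C_mul, coeff_C_mul]
  rcases i with _ | i
  · rw [coeff_X_mul_zero, coeff_laguerrePoly, coeff_laguerrePoly, if_pos (by omega),
      if_pos (by omega)]
    have h := Nat.add_one_mul_choose_eq (k + a) k
    have h' : ((k + a : ℝ) + 1) * ((k + a).choose k : ℝ) =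
        ((k + a + 1).choose (k + 1) : ℝ) * (k + 1) := by exact_mod_cast h
    simp only [Nat.sub_zero, pow_zero, one_mul, Nat.factorial_zero, Nat.cast_one, div_one]
    rw [show k + 1 + a = k + a + 1 by ring]
    linear_combination -h'
  · rw [coeff_X_mul, coeff_laguerrePoly, coeff_laguerrePoly, coeff_laguerrePoly]
    have hf : (i.factorial : ℝ) ≠ 0 := by positivity
    by_cases h : i + 1 ≤ k
    · rw [if_pos h, if_pos (by omega), if_pos (by omega)]
      obtain ⟨d, rfl⟩ := Nat.exists_eq_add_of_le h
      rw [show i + 1 + d + 1 - (i + 1) = d + 1 by omega, show i + 1 + d - (i + 1) = d by omega,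
        show i + 1 + d - i = d + 1 by omega,
        show i + 1 + d + 1 + a = (i + 1 + d + a) + 1 by ring,
        show i + 1 + d + (a + 1) = (i + 1 + d + a) + 1 by ring]
      have h := Nat.add_one_mul_choose_eq (i + 1 + d + a) d
      have h' : ((i + 1 + d + a : ℝ) + 1) * ((i + 1 + d + a).choose d : ℝ) =
        ((i + 1 + d + a + 1).choose (d + 1) : ℝ) * (d + 1) := by exact_mod_cast h
      rw [Nat.factorial_succ]
      push_cast
      field_simp
      linear_combination (-1 : ℝ) ^ (i + 1) * (-h')
    -- The leading coefficient `i + 1 = k + 1` is separate: `L_k^a` contributes nothing there.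
    · by_cases h2 : i ≤ k
      · obtain rfl : i = k := by omega
        rw [if_neg h, if_pos le_rfl, if_pos le_rfl, Nat.factorial_succ]
        push_cast
        simp only [Nat.sub_self, Nat.choose_zero_right]
        field_simp
        push_cast; ring
      · rw [if_neg h, if_neg (by omega), if_neg h2]; simp

/-- Rodrigues' formula in one-step form, with the factor `x^a e^{-x}` removed: `(x^{a+1} e^{-x}
L_k^{a+1})' = (k+1) x^a e^{-x} L_{k+1}^a`. This is what makes integration by parts work for the
orthogonality relations. -/
theorem laguerrePoly_succ' (k a : ℕ) :
    C (k + 1 : ℝ) * laguerrePoly (k + 1) a =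
      X * derivative (laguerrePoly k (a + 1)) + C (a + 1 : ℝ) * laguerrePoly k (a + 1)
        - X * laguerrePoly k (a + 1) := by
  ext i
  rw [coeff_sub, coeff_add, coeff_C_mul, coeff_C_mul]
  rcases i with _ | i
  · rw [coeff_X_mul_zero, coeff_X_mul_zero, coeff_laguerrePoly, coeff_laguerrePoly,
      if_pos (by omega), if_pos (by omega)]
    have h := Nat.choose_succ_right_eq (k + a + 1) k
    rw [show k + a + 1 - k = a + 1 by omega] at h
    have h' : ((k + a + 1).choose (k + 1) : ℝ) * (k + 1) =
        ((k + a + 1).choose k : ℝ) * (a + 1) := by exact_mod_cast h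
    simp only [Nat.sub_zero, pow_zero, one_mul, Nat.factorial_zero, Nat.cast_one, div_one]
    rw [show k + 1 + a = k + a + 1 by ring, ← add_assoc]
    linear_combination h'
  · rw [coeff_X_mul, coeff_X_mul, coeff_derivative, coeff_laguerrePoly, coeff_laguerrePoly,
      coeff_laguerrePoly]
    have hf : (i.factorial : ℝ) ≠ 0 := by positivity
    by_cases h : i + 1 ≤ k
    · rw [if_pos h, if_pos (by omega), if_pos (by omega)]
      obtain ⟨d, rfl⟩ := Nat.exists_eq_add_of_le h
      rw [show i + 1 + d + 1 - (i + 1) = d + 1 by omega, show i + 1 + d - (i + 1) = d by omega,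
        show i + 1 + d - i = d + 1 by omega,
        show i + 1 + d + 1 + a = (i + 1 + d + a) + 1 by ring,
        show i + 1 + d + (a + 1) = (i + 1 + d + a) + 1 by ring]
      have h := Nat.choose_succ_right_eq (i + 1 + d + a + 1) d
      rw [show i + 1 + d + a + 1 - d = i + a + 2 by omega] at h
      have h' : ((i + 1 + d + a + 1).choose (d + 1) : ℝ) * (d + 1) =
        ((i + 1 + d + a + 1).choose d : ℝ) * (i + a + 2) := by exact_mod_cast h
      rw [Nat.factorial_succ]
      push_cast
      field_simp
      linear_combination (-1 : ℝ) ^ (i + 1) * h'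
    · by_cases h2 : i ≤ k
      · obtain rfl : i = k := by omega
        rw [if_neg h, if_pos le_rfl, if_pos le_rfl, Nat.factorial_succ]
        push_cast
        simp only [Nat.sub_self, Nat.choose_zero_right]
        field_simp
        push_cast; ring
      · rw [if_neg h, if_neg (by omega), if_neg h2]; simp

/-- The linear functional `P ↦ ∫₀^∞ P(t) e^{-t} dt`, that is, `X ^ i ↦ i!`. -/
def expFunctional : ℝ[X] →ₗ[ℝ] ℝ :=
  lsum fun i => (i.factorial : ℝ) • LinearMap.id

theorem expFunctional_monomial (i : ℕ) (c : ℝ) :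
    expFunctional (monomial i c) = i.factorial * c := by
  simp [expFunctional, lsum_apply, sum_monomial_index]

/-- Integration by parts against `e^{-t}` on the half-line, in purely algebraic form. -/
theorem expFunctional_derivative (P : ℝ[X]) :
    expFunctional (derivative P) = expFunctional P - P.eval 0 := by
  induction P using Polynomial.induction_on' with
  | add p q hp hq => simp only [map_add, hp, hq, eval_add]; ring
  | monomial i c =>
    rcases i with _ | i
    · rw [expFunctional_monomial]; simp
    · rw [derivative_monomial, expFunctional_monomial, expFunctional_monomial, Nat.factorial_succ]
      simp only [eval_monomial]
      push_cast
      simp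
      ring

/-- Rodrigues' formula followed by integration by parts. The boundary term at `0` vanishes because
of the factor `X ^ (a + 1)`. -/
theorem expFunctional_laguerrePoly_succ_mul (k a : ℕ) (P : ℝ[X]) :
    (k + 1) * expFunctional (X ^ a * laguerrePoly (k + 1) a * P) =
      -expFunctional (X ^ (a + 1) * laguerrePoly k (a + 1) * derivative P) := by
  have h := expFunctional_derivative (X ^ (a + 1) * laguerrePoly k (a + 1) * P)
  have h2 : derivative (X ^ (a + 1) * laguerrePoly k (a + 1) * P) =
      X ^ (a + 1) * laguerrePoly k (a + 1) * P + C (k + 1 : ℝ) * (X ^ a * laguerrePoly (k + 1) a * P)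
      + X ^ (a + 1) * laguerrePoly k (a + 1) * derivative P := by
    simp only [derivative_mul, derivative_X_pow, Nat.add_sub_cancel]
    push_cast
    have := laguerrePoly_succ' k a
    simp only [map_add, map_natCast, map_one] at this ⊢
    linear_combination -X ^ a * P * this
  rw [h2, map_add, map_add, ← smul_eq_C_mul, map_smul, smul_eq_mul] at h
  simp only [eval_mul, eval_pow, eval_X] at h
  simp only [ne_eq, Nat.add_eq_zero_iff, one_ne_zero, and_false, not_false_eq_true, zero_pow,
    zero_mul, sub_zero] at h
  linear_combination h

/-- Moving the derivative onto the second factor lowers both degrees by one and raises the type by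
one, so induction on `k`, for all `l` and `a`, reduces to the case where one degree is `0`. -/
theorem expFunctional_laguerrePoly_mul (k l a : ℕ) :
    expFunctional (X ^ a * laguerrePoly k a * laguerrePoly l a) =
      if k = l then ((k + a).factorial : ℝ) / k.factorial else 0 := by
  induction k generalizing l a with
  | zero =>
    rcases l with _ | l
    · simp only [laguerrePoly_zero, mul_one, X_pow_eq_monomial, expFunctional_monomial]; simp
    · have h := expFunctional_laguerrePoly_succ_mul l a 1
      simp only [derivative_one, mul_zero, map_zero, neg_zero, mul_one, mul_eq_zero] at h
      rw [laguerrePoly_zero, mul_one, if_neg (by omega)]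
      exact h.resolve_left (by positivity)
  | succ k ih =>
    have h := expFunctional_laguerrePoly_succ_mul k a (laguerrePoly l a)
    have hk : (k + 1 : ℝ) ≠ 0 := by positivity
    rcases l with _ | l
    · rw [laguerrePoly_zero, derivative_one] at h
      simp only [mul_zero, map_zero, neg_zero, mul_eq_zero] at h
      rw [laguerrePoly_zero, if_neg (by omega)]
      exact h.resolve_left (by positivity)
    · rw [derivative_laguerrePoly_succ, mul_neg, map_neg, neg_neg, ih] at h
      rw [← mul_right_inj' hk, h]
      by_cases hkl : k = l
      · subst hkl
        rw [if_pos rfl, if_pos rfl, Nat.factorial_succ k, show k + 1 + a = k + (a + 1) by ring]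
        have : (k.factorial : ℝ) ≠ 0 := by positivity
        push_cast
        field_simp
      · rw [if_neg hkl, if_neg (by omega), mul_zero]

/-! ### Radial integrals and orthonormality of the Laguerre functions -/

theorem integral_radialMeasure (a : ℕ) (f : ℝ → ℝ) :
    ∫ r, f r ∂radialMeasure a = ∫ r in Set.Ioi 0, r ^ (2 * a + 1) * f r := by
  rw [radialMeasure, integral_withDensity_eq_integral_toReal_smul (by fun_prop) (by simp)]
  refine setIntegral_congr_fun measurableSet_Ioi fun r hr => ?_
  have : (0 : ℝ) < r := hr
  simp only [smul_eq_mul]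
  rw [ENNReal.toReal_ofReal (by positivity)]

theorem integrable_poly_mul_exp (P : ℝ[X]) :
    Integrable fun r : ℝ => P.eval r * Real.exp (-(r ^ 2) / 2) := by
  have h := (integrable_poly_gauss (P.map Complex.ofRealHom) (b := 1 / 2) (by norm_num)).re
  refine h.congr (Filter.Eventually.of_forall fun r => ?_)
  have h1 : (P.map Complex.ofRealHom).eval (r : ℂ) = ((P.eval r : ℝ) : ℂ) :=
    Polynomial.eval_map_apply (f := Complex.ofRealHom) (p := P) r
  simp only [h1, ← Complex.ofReal_mul]
  rw [show -(1 / 2) * r ^ 2 = -(r ^ 2) / 2 by ring]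
  rfl

theorem integral_odd_pow_mul_exp (i : ℕ) :
    ∫ r in Set.Ioi (0 : ℝ), r ^ (2 * i + 1) * Real.exp (-(r ^ 2) / 2) = 2 ^ i * i.factorial := by
  have h := integral_rpow_mul_exp_neg_mul_rpow (p := 2) (q := (2 * i + 1 : ℕ)) (b := 1 / 2)
    two_pos (by have : (0 : ℝ) ≤ (2 * i + 1 : ℕ) := Nat.cast_nonneg _; linarith) (by norm_num)
  have e : (((2 * i + 1 : ℕ) : ℝ) + 1) / 2 = i + 1 := by push_cast; ring
  rw [e, neg_div, e, Real.Gamma_nat_eq_factorial] at h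
  have e2 : (1 / 2 : ℝ) ^ (-(i + 1 : ℝ)) = 2 ^ i * 2 := by
    rw [one_div, Real.inv_rpow (by norm_num), ← Real.rpow_neg (by norm_num), neg_neg,
      Real.rpow_add_one (by norm_num), Real.rpow_natCast]
  rw [e2] at h
  rw [show (2 : ℝ) ^ i * i.factorial = 2 ^ i * 2 * (1 / 2) * i.factorial by ring, ← h]
  refine setIntegral_congr_fun measurableSet_Ioi fun r _ => ?_
  simp only [Real.rpow_natCast]
  rw [Real.rpow_two, show -(r ^ 2) / 2 = -(1 / 2) * r ^ 2 by ring]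

/-- The substitution `t = r²/2`, checked on monomials through the Gamma integral. -/
theorem integral_poly_radial (a : ℕ) (P : ℝ[X]) :
    ∫ r in Set.Ioi (0 : ℝ), r ^ (2 * a + 1) * (P.eval (r ^ 2 / 2) * Real.exp (-(r ^ 2) / 2)) =
      2 ^ a * expFunctional (X ^ a * P) := by
  have hi : ∀ P : ℝ[X], Integrable (fun r : ℝ => r ^ (2 * a + 1) *
      (P.eval (r ^ 2 / 2) * Real.exp (-(r ^ 2) / 2))) := by
    intro P
    refine (integrable_poly_mul_exp (X ^ (2 * a + 1) * P.comp (C (1 / 2) * X ^ 2))).congr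
      (Filter.Eventually.of_forall fun r => ?_)
    simp only [eval_mul, eval_pow, eval_X, eval_comp, eval_C]
    rw [show (1 / 2 : ℝ) * r ^ 2 = r ^ 2 / 2 by ring]
    ring
  induction P using Polynomial.induction_on' with
  | add p q hp hq =>
    rw [mul_add, map_add, mul_add, ← hp, ← hq, ← integral_add (hi p).integrableOn
      (hi q).integrableOn]
    simp only [eval_add]
    congr 1; ext r; ring
  | monomial i c =>
    rw [X_pow_mul_monomial, expFunctional_monomial]
    have h := integral_odd_pow_mul_exp (i + a)
    have : ∀ r : ℝ, r ^ (2 * a + 1) * ((monomial i c).eval (r ^ 2 / 2) * Real.exp (-(r ^ 2) / 2))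
        = (c / 2 ^ i) * (r ^ (2 * (i + a) + 1) * Real.exp (-(r ^ 2) / 2)) := by
      intro r
      rw [eval_monomial, div_pow, ← pow_mul]
      field_simp
      ring
    simp only [this]
    rw [integral_const_mul, h, pow_add]
    field_simp

/-- The normalized Laguerre function of type `a` in one variable. -/
def psi (k a : ℕ) (r : ℝ) : ℝ :=
  Real.sqrt (k.factorial / (2 ^ a * (k + a).factorial)) * laguerreFun k a r

theorem Psi_eq_prod {n : ℕ} (m α : Fin n → ℕ) (r : Fin n → ℝ) :
    Psi m α r = ((∏ i, psi (α i) (m i) (r i) : ℝ) : ℂ) := rfl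

/-- A factor `r^s` in each function turns the measure of type `a` into that of type `a + s`. The
shift `s` lets one computation serve both `Ψ_α^m` and `r_j Ψ_α^{m+e_j}` in `L²(dμ_m)`. -/
theorem integral_psi_mul_psi (k l a s : ℕ) :
    ∫ r, (r ^ s * psi k (a + s) r) * (r ^ s * psi l (a + s) r) ∂radialMeasure a =
      if k = l then 1 else 0 := by
  rw [integral_radialMeasure]
  set b := a + s with hb
  have h := integral_poly_radial b (laguerrePoly k b * laguerrePoly l b)
  have h2 : ∀ r : ℝ, r ^ (2 * a + 1) * ((r ^ s * psi k b r) * (r ^ s * psi l b r)) =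
      (Real.sqrt (k.factorial / (2 ^ b * (k + b).factorial)) *
        Real.sqrt (l.factorial / (2 ^ b * (l + b).factorial))) * (r ^ (2 * b + 1) *
        ((laguerrePoly k b * laguerrePoly l b).eval (r ^ 2 / 2) * Real.exp (-(r ^ 2) / 2))) := by
    intro r
    have he : Real.exp (-(r ^ 2) / 2) = Real.exp (-(r ^ 2) / 4) * Real.exp (-(r ^ 2) / 4) := by
      rw [← Real.exp_add]; congr 1; ring
    rw [eval_mul, he, psi, psi, laguerreFun, laguerreFun, hb]
    ring
  simp only [h2]
  rw [integral_const_mul, h, ← mul_assoc (X ^ b), expFunctional_laguerrePoly_mul]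
  split_ifs with hkl
  · subst hkl
    rw [Real.mul_self_sqrt (by positivity)]
    have : (k.factorial : ℝ) ≠ 0 := by positivity
    have : ((k + b).factorial : ℝ) ≠ 0 := by positivity
    field_simp
  · simp

theorem integral_Psi_mul_Psi {n : ℕ} (m s α β : Fin n → ℕ) :
    ∫ r, ((∏ i, (r i : ℂ) ^ s i) * Psi (m + s) α r) * ((∏ i, (r i : ℂ) ^ s i) * Psi (m + s) β r)
      ∂muMeasure m = if α = β then 1 else 0 := by
  have h : ∀ r : Fin n → ℝ, ((∏ i, (r i : ℂ) ^ s i) * Psi (m + s) α r) *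
      ((∏ i, (r i : ℂ) ^ s i) * Psi (m + s) β r) =
      ((∏ i, ((r i ^ s i * psi (α i) (m i + s i) (r i)) *
        (r i ^ s i * psi (β i) (m i + s i) (r i))) : ℝ) : ℂ) := by
    intro r
    simp only [Psi_eq_prod, Finset.prod_mul_distrib]
    push_cast
    simp only [Pi.add_apply]
  simp only [h]
  rw [integral_complex_ofReal, muMeasure, integral_fintype_prod_eq_prod (f := fun i (r : ℝ) =>
    (r ^ s i * psi (α i) (m i + s i) r) * (r ^ s i * psi (β i) (m i + s i) r))]
  simp only [integral_psi_mul_psi]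
  rw [Finset.prod_ite_zero]
  simp only [Finset.mem_univ, true_imp_iff, Finset.prod_const_one, funext_iff]
  split_ifs <;> simp

theorem conj_Psi {n : ℕ} (m α : Fin n → ℕ) (r : Fin n → ℝ) :
    (starRingEnd ℂ) (Psi m α r) = Psi m α r := Complex.conj_ofReal _

theorem orthonormal_PsiLp {n : ℕ} (m : Fin n → ℕ) : Orthonormal ℂ (PsiLp m) := by
  rw [orthonormal_iff_ite]
  intro α β
  rw [L2.inner_def, ← integral_Psi_mul_Psi m 0 α β]
  refine integral_congr_ae ?_
  filter_upwards [(memLp_Psi m α).coeFn_toLp, (memLp_Psi m β).coeFn_toLp] with r h1 h2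
  rw [PsiLp, PsiLp, h1, h2]
  simp [conj_Psi, mul_comm]

/-- Truncated subtraction identifies the indices with `α_j = 0` and `α_j = 1`, so this family is
orthonormal only after restriction to `α_j ≥ 1`. -/
theorem inner_PsiShiftLp {n : ℕ} (j : Fin n) (m α β : Fin n → ℕ) :
    inner ℂ (PsiShiftLp j m α) (PsiShiftLp j m β) =
      if α - Pi.single j 1 = β - Pi.single j 1 then 1 else 0 := by
  rw [L2.inner_def, ← integral_Psi_mul_Psi m (Pi.single j 1)]
  have hr : ∀ r : Fin n → ℝ, ∏ i, (r i : ℂ) ^ (Pi.single j 1 : Fin n → ℕ) i = r j := by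
    intro r
    rw [Finset.prod_eq_single j] <;> simp +contextual
  refine integral_congr_ae ?_
  filter_upwards [(memLp_coord_mul_Psi j m (m + Pi.single j 1) (α - Pi.single j 1)).coeFn_toLp,
    (memLp_coord_mul_Psi j m (m + Pi.single j 1) (β - Pi.single j 1)).coeFn_toLp] with r h1 h2
  rw [PsiShiftLp, PsiShiftLp, h1, h2, hr]
  simp [conj_Psi, mul_comm]

/-! ### Hermite functions -/

theorem derivative_hermite_succ (k : ℕ) :
    derivative (hermite (k + 1)) = (k + 1 : ℤ[X]) * hermite k := by
  induction k with
  | zero => simp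
  | succ k ih =>
    rw [hermite_succ (k + 1), derivative_sub, derivative_mul, derivative_X, ih, derivative_mul]
    have : derivative ((k : ℤ[X]) + 1) = 0 := by simp
    rw [this, hermite_succ k]
    push_cast
    ring

theorem derivative_hermite (k : ℕ) :
    derivative (hermite k) = (k : ℤ[X]) * hermite (k - 1) := by
  rcases k with _ | k
  · simp
  · rw [derivative_hermite_succ]; simp

/-- The factor `√2` comes from evaluating the probabilists' Hermite polynomial at `√2 s`. -/
theorem hermiteFun_normalization_succ (k : ℕ) :
    Real.sqrt (2 * k + 2) * (Real.sqrt ((k + 1).factorial * Real.sqrt Real.pi))⁻¹ =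
      Real.sqrt 2 * (Real.sqrt (k.factorial * Real.sqrt Real.pi))⁻¹ := by
  rw [Nat.factorial_succ, show (2 * k + 2 : ℝ) = 2 * (k + 1) by ring, Real.sqrt_mul (by norm_num)]
  push_cast
  rw [mul_assoc (k + 1 : ℝ), Real.sqrt_mul (x := (k + 1 : ℝ)) (by positivity)]
  have : Real.sqrt (k + 1 : ℝ) ≠ 0 := by positivity
  field_simp

theorem hermiteFun_normalization_pred (k : ℕ) :
    Real.sqrt 2 * (k * (Real.sqrt (k.factorial * Real.sqrt Real.pi))⁻¹) =
      Real.sqrt (2 * k) * (Real.sqrt ((k - 1).factorial * Real.sqrt Real.pi))⁻¹ := by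
  rcases k with _ | k
  · simp
  · have h := hermiteFun_normalization_succ k
    rw [show (2 * k + 2 : ℝ) = 2 * (k + 1) by ring] at h
    have h2 : Real.sqrt (2 * (k + 1 : ℝ)) * Real.sqrt (2 * (k + 1 : ℝ)) = 2 * (k + 1) :=
      Real.mul_self_sqrt (by positivity)
    have h3 : Real.sqrt 2 * Real.sqrt 2 = 2 := Real.mul_self_sqrt (by positivity)
    have h4 : Real.sqrt 2 ≠ 0 := by positivity
    simp only [Nat.add_sub_cancel]
    push_cast
    apply mul_left_cancel₀ h4
    linear_combination Real.sqrt (2 * (k + 1 : ℝ)) * h +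
      (Real.sqrt ((k + 1).factorial * Real.sqrt Real.pi))⁻¹ * ((k + 1) * h3 - h2)

theorem hasDerivAt_hermiteFun (k : ℕ) (s : ℝ) :
    HasDerivAt (hermiteFun k) (Real.sqrt (2 * k) * hermiteFun (k - 1) s - s * hermiteFun k s) s := by
  have h1 : HasDerivAt (fun s : ℝ => Real.sqrt 2 * s) (Real.sqrt 2) s := by
    simpa using (hasDerivAt_id s).const_mul (Real.sqrt 2)
  have h2 := ((hermite k).hasDerivAt_aeval (Real.sqrt 2 * s)).comp s h1
  have h3 : HasDerivAt (fun s : ℝ => Real.exp (-(s ^ 2) / 2)) (Real.exp (-(s ^ 2) / 2) * (-s)) s := by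
    have := (((hasDerivAt_id s).pow 2).neg.div_const 2).exp
    refine this.congr_deriv ?_
    simp
    ring
  have h4 := (h2.const_mul (Real.sqrt (k.factorial * Real.sqrt Real.pi))⁻¹).mul h3
  refine h4.congr_deriv ?_
  have hn := hermiteFun_normalization_pred k
  simp only [Function.comp, hermiteFun, derivative_hermite, map_mul, map_natCast]
  linear_combination (aeval (Real.sqrt 2 * s) (hermite (k - 1)) * Real.exp (-(s ^ 2) / 2)) * hn

theorem hermiteFun_recurrence (k : ℕ) (s : ℝ) :
    2 * (s * hermiteFun k s) =
      Real.sqrt (2 * k) * hermiteFun (k - 1) s + Real.sqrt (2 * k + 2) * hermiteFun (k + 1) s := by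
  have hn := hermiteFun_normalization_pred k
  have hn' := hermiteFun_normalization_succ k
  have h3 : Real.sqrt 2 * Real.sqrt 2 = 2 := Real.mul_self_sqrt (by positivity)
  simp only [hermiteFun, hermite_succ, derivative_hermite, map_mul, map_natCast, map_sub, aeval_X]
  linear_combination (aeval (Real.sqrt 2 * s) (hermite (k - 1)) * Real.exp (-(s ^ 2) / 2)) * hn
   - (Real.exp (-(s ^ 2) / 2) * ((Real.sqrt 2 * s) * aeval (Real.sqrt 2 * s) (hermite k) -
      k * aeval (Real.sqrt 2 * s) (hermite (k - 1)))) * hn' - (Real.exp (-(s ^ 2) / 2) * s *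
      aeval (Real.sqrt 2 * s) (hermite k) * (Real.sqrt (k.factorial * Real.sqrt Real.pi))⁻¹) * h3

theorem memLp_hermiteFun (k : ℕ) : MemLp (hermiteFun k) 2 := by
  have h := (memLp_poly_gauss (C (((Real.sqrt (k.factorial * Real.sqrt Real.pi))⁻¹ : ℝ) : ℂ) *
    ((hermite k).map (Int.castRingHom ℂ)).comp (C ((Real.sqrt 2 : ℝ) : ℂ) * X))
    (b := 1 / 2) (by norm_num)).re
  refine h.ae_eq (Filter.Eventually.of_forall fun s => ?_)
  have h1 : ((hermite k).map (Int.castRingHom ℂ)).eval (((Real.sqrt 2 * s : ℝ)) : ℂ) =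
      ((aeval (Real.sqrt 2 * s) (hermite k) : ℝ) : ℂ) := by
    rw [eval_map, ← Complex.ofRealHom_eq_coe, ← Complex.ofRealHom_eq_coe, aeval_def, hom_eval₂]
    congr 1
  simp only [eval_mul, eval_C, eval_comp, eval_X, ← Complex.ofReal_mul, h1]
  rw [show -(1 / 2) * s ^ 2 = -(s ^ 2) / 2 by ring]
  rfl

/-! ### Special Hermite functions in one variable -/

theorem norm_exp_I_mul (x ξ : ℝ) : ‖Complex.exp (Complex.I * x * ξ)‖ = 1 := by
  rw [show Complex.I * x * ξ = ((x * ξ : ℝ) : ℂ) * Complex.I by push_cast; ring,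
    Complex.norm_exp_ofReal_mul_I]

theorem integrable_fourierWigner (k l : ℕ) (x y : ℝ) :
    Integrable fun ξ : ℝ => Complex.exp (Complex.I * x * ξ) *
      ((hermiteFun k (ξ + y / 2) * hermiteFun l (ξ - y / 2) : ℝ) : ℂ) := by
  have h1 := (memLp_hermiteFun k).comp_measurePreserving
    (measurePreserving_add_right volume (y / 2))
  have h2 := (memLp_hermiteFun l).comp_measurePreserving
    (measurePreserving_sub_right volume (y / 2))
  exact (h1.integrable_mul h2).ofReal.bdd_mul (c := 1)
    (Continuous.aestronglyMeasurable (by fun_prop))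
    (Filter.Eventually.of_forall fun ξ => (norm_exp_I_mul x ξ).le)

/-- The integral over `ξ` of the derivative of `e^{ixξ} h_k(ξ+y/2) h_l(ξ-y/2)` is zero. The Hermite
derivatives and the multiplications by `ξ ± y/2` are then expressed through neighbouring indices. -/
theorem re_mul_specialHermite₁ (k l : ℕ) (z : ℂ) :
    2 * (Complex.I * z.re * specialHermite₁ k l z) =
      -(Real.sqrt (2 * k) * specialHermite₁ (k - 1) l z -
        Real.sqrt (2 * k + 2) * specialHermite₁ (k + 1) l z +
        Real.sqrt (2 * l) * specialHermite₁ k (l - 1) z -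
        Real.sqrt (2 * l + 2) * specialHermite₁ k (l + 1) z) := by
  set e : ℕ → ℕ → ℝ → ℂ := fun k l ξ => Complex.exp (Complex.I * z.re * ξ) *
      ((hermiteFun k (ξ + z.im / 2) * hermiteFun l (ξ - z.im / 2) : ℝ) : ℂ) with he
  have hi : ∀ k l, Integrable (e k l) := fun k l => integrable_fourierWigner k l z.re z.im
  have hd : ∀ ξ : ℝ, HasDerivAt (e k l) (Complex.I * z.re * e k l ξ +
      ((Real.sqrt (2 * k) / 2) * e (k - 1) l ξ - (Real.sqrt (2 * k + 2) / 2) * e (k + 1) l ξ +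
      ((Real.sqrt (2 * l) / 2) * e k (l - 1) ξ - (Real.sqrt (2 * l + 2) / 2) * e k (l + 1) ξ))) ξ := by
    intro ξ
    have hid : HasDerivAt (fun ξ : ℝ => (ξ : ℂ)) 1 ξ := Complex.ofRealCLM.hasDerivAt
    have h1 := (hid.const_mul (Complex.I * z.re)).cexp
    have h2 := ((hasDerivAt_hermiteFun k (ξ + z.im / 2)).comp_add_const ξ (z.im / 2)).fun_mul
      ((hasDerivAt_hermiteFun l (ξ - z.im / 2)).comp_sub_const ξ (z.im / 2))
    refine (h1.fun_mul h2.ofReal_comp).congr_deriv ?_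
    have r1 := congrArg (fun t : ℝ => (t : ℂ)) (hermiteFun_recurrence k (ξ + z.im / 2))
    have r2 := congrArg (fun t : ℝ => (t : ℂ)) (hermiteFun_recurrence l (ξ - z.im / 2))
    simp only [he]
    push_cast at r1 r2 ⊢
    linear_combination (-(1 / 2) * Complex.exp (Complex.I * z.re * ξ) *
      (hermiteFun l (ξ - z.im / 2) : ℂ)) * r1 + (-(1 / 2) * Complex.exp (Complex.I * z.re * ξ) *
      (hermiteFun k (ξ + z.im / 2) : ℂ)) * r2
  have i0 := (hi k l).const_mul (Complex.I * z.re)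
  have i1 := (hi (k - 1) l).const_mul (Real.sqrt (2 * k) / 2 : ℂ)
  have i2 := (hi (k + 1) l).const_mul (Real.sqrt (2 * k + 2) / 2 : ℂ)
  have i3 := (hi k (l - 1)).const_mul (Real.sqrt (2 * l) / 2 : ℂ)
  have i4 := (hi k (l + 1)).const_mul (Real.sqrt (2 * l + 2) / 2 : ℂ)
  have h0 := integral_eq_zero_of_hasDerivAt_of_integrable hd
    (i0.add ((i1.sub i2).add (i3.sub i4))) (hi k l)
  rw [integral_add i0 (by exact (i1.sub i2).add (i3.sub i4)),
    integral_add (by exact i1.sub i2) (by exact i3.sub i4),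
    integral_sub i1 i2, integral_sub i3 i4] at h0
  simp only [integral_const_mul] at h0
  simp only [specialHermite₁]
  simp only [he] at h0
  linear_combination (2 * (((Real.sqrt (2 * Real.pi))⁻¹ : ℝ) : ℂ)) * h0

/-- Write `y = (ξ + y/2) - (ξ - y/2)` under the integral and apply the three-term recurrence to each
factor. -/
theorem im_mul_specialHermite₁ (k l : ℕ) (z : ℂ) :
    2 * (z.im * specialHermite₁ k l z) =
      Real.sqrt (2 * k) * specialHermite₁ (k - 1) l z +
        Real.sqrt (2 * k + 2) * specialHermite₁ (k + 1) l z -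
        (Real.sqrt (2 * l) * specialHermite₁ k (l - 1) z +
        Real.sqrt (2 * l + 2) * specialHermite₁ k (l + 1) z) := by
  set e : ℕ → ℕ → ℝ → ℂ := fun k l ξ => Complex.exp (Complex.I * z.re * ξ) *
      ((hermiteFun k (ξ + z.im / 2) * hermiteFun l (ξ - z.im / 2) : ℝ) : ℂ) with he
  have hi : ∀ k l, Integrable (e k l) := fun k l => integrable_fourierWigner k l z.re z.im
  have hd : ∀ ξ : ℝ, (2 * z.im) * e k l ξ =
      (Real.sqrt (2 * k)) * e (k - 1) l ξ + (Real.sqrt (2 * k + 2)) * e (k + 1) l ξ -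
      ((Real.sqrt (2 * l)) * e k (l - 1) ξ + (Real.sqrt (2 * l + 2)) * e k (l + 1) ξ) := by
    intro ξ
    have r1 := congrArg (fun t : ℝ => (t : ℂ)) (hermiteFun_recurrence k (ξ + z.im / 2))
    have r2 := congrArg (fun t : ℝ => (t : ℂ)) (hermiteFun_recurrence l (ξ - z.im / 2))
    simp only [he]
    push_cast at r1 r2 ⊢
    linear_combination (Complex.exp (Complex.I * z.re * ξ) *
      (hermiteFun l (ξ - z.im / 2) : ℂ)) * r1 - (Complex.exp (Complex.I * z.re * ξ) *
      (hermiteFun k (ξ + z.im / 2) : ℂ)) * r2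
  have i1 := (hi (k - 1) l).const_mul (Real.sqrt (2 * k) : ℂ)
  have i2 := (hi (k + 1) l).const_mul (Real.sqrt (2 * k + 2) : ℂ)
  have i3 := (hi k (l - 1)).const_mul (Real.sqrt (2 * l) : ℂ)
  have i4 := (hi k (l + 1)).const_mul (Real.sqrt (2 * l + 2) : ℂ)
  have h0 := congrArg (fun f : ℝ → ℂ => ∫ ξ, f ξ) (funext hd)
  rw [integral_sub (by exact i1.add i2) (by exact i3.add i4), integral_add i1 i2, integral_add i3 i4] at h0
  simp only [integral_const_mul] at h0
  simp only [specialHermite₁]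
  simp only [he] at h0
  linear_combination (((Real.sqrt (2 * Real.pi))⁻¹ : ℝ) : ℂ) * h0

/-- The formulas for multiplication by `x` and `y` combine into multiplication by `z`, which
eliminates two of the four neighbours. Together with the conjugate version this generates every
`Φ_{k,l}` from the Gaussian `Φ_{0,0}`, with no differentiation in `z`. -/
theorem specialHermite₁_succ_right (k l : ℕ) (z : ℂ) :
    Real.sqrt (2 * l + 2) * specialHermite₁ k (l + 1) z =
      Real.sqrt (2 * k) * specialHermite₁ (k - 1) l z + Complex.I * z * specialHermite₁ k l z := by
  have h1 := re_mul_specialHermite₁ k l z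
  have h2 := im_mul_specialHermite₁ k l z
  have hz : Complex.I * z = Complex.I * z.re - z.im := by
    conv_lhs => rw [← Complex.re_add_im z]
    linear_combination (z.im : ℂ) * Complex.I_mul_I
  rw [hz]
  linear_combination -(1 / 2) * h1 + (1 / 2) * h2

theorem specialHermite₁_succ_left (k l : ℕ) (z : ℂ) :
    Real.sqrt (2 * k + 2) * specialHermite₁ (k + 1) l z =
      Real.sqrt (2 * l) * specialHermite₁ k (l - 1) z +
        Complex.I * (starRingEnd ℂ) z * specialHermite₁ k l z := by
  have h1 := re_mul_specialHermite₁ k l z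
  have h2 := im_mul_specialHermite₁ k l z
  have hz : Complex.I * (starRingEnd ℂ) z = Complex.I * z.re + z.im := by
    apply Complex.ext <;> simp
  rw [hz]
  linear_combination -(1 / 2) * h1 - (1 / 2) * h2

theorem specialHermite₁_zero_zero (z : ℂ) :
    specialHermite₁ 0 0 z = ((Real.sqrt (2 * Real.pi))⁻¹ : ℝ) * (Real.exp (-(‖z‖ ^ 2) / 4) : ℝ) := by
  rw [specialHermite₁]
  congr 1
  have h := fourierIntegral_gaussian (b := 1) (by simp) (z.re : ℂ)
  have hs : (Real.pi : ℂ) ^ (1 / 2 : ℂ) = ((Real.sqrt Real.pi : ℝ) : ℂ) := by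
    rw [Real.sqrt_eq_rpow, Complex.ofReal_cpow Real.pi_pos.le]; simp
  have e : ∀ ξ : ℝ, Complex.exp (Complex.I * z.re * ξ) *
      ((hermiteFun 0 (ξ + z.im / 2) * hermiteFun 0 (ξ - z.im / 2) : ℝ) : ℂ) =
      ((Real.sqrt Real.pi)⁻¹ * Real.exp (-(z.im ^ 2) / 4) : ℝ) *
        (Complex.exp (Complex.I * z.re * ξ) * Complex.exp (-1 * ξ ^ 2)) := by
    intro ξ
    have : hermiteFun 0 (ξ + z.im / 2) * hermiteFun 0 (ξ - z.im / 2) =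
        ((Real.sqrt Real.pi)⁻¹ * Real.exp (-(z.im ^ 2) / 4)) * Real.exp (-1 * ξ ^ 2) := by
      have h1 : Real.exp (-((ξ + z.im / 2) ^ 2) / 2) * Real.exp (-((ξ - z.im / 2) ^ 2) / 2) =
          Real.exp (-(z.im ^ 2) / 4) * Real.exp (-1 * ξ ^ 2) := by
        rw [← Real.exp_add, ← Real.exp_add]; congr 1; ring
      have h2 : (Real.sqrt (Real.sqrt Real.pi))⁻¹ * (Real.sqrt (Real.sqrt Real.pi))⁻¹ =
          (Real.sqrt Real.pi)⁻¹ := by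
        rw [← mul_inv, Real.mul_self_sqrt (by positivity)]
      simp only [hermiteFun, hermite_zero, map_one, Nat.factorial_zero, Nat.cast_one, one_mul,
        mul_one]
      linear_combination (Real.sqrt (Real.sqrt Real.pi))⁻¹ * (Real.sqrt (Real.sqrt Real.pi))⁻¹ * h1
        + Real.exp (-(z.im ^ 2) / 4) * Real.exp (-1 * ξ ^ 2) * h2
    rw [this]
    push_cast
    ring
  simp only [e]
  rw [integral_const_mul, h, div_one, hs, Complex.sq_norm, Complex.normSq_apply]
  have h3 : Complex.exp (-(z.re : ℂ) ^ 2 / (4 * 1)) = ((Real.exp (-(z.re ^ 2) / 4) : ℝ) : ℂ) := by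
    push_cast; congr 1; ring
  rw [h3, ← Complex.ofReal_mul, ← Complex.ofReal_mul]
  congr 1
  have : Real.exp (-(z.re * z.re + z.im * z.im) / 4) =
      Real.exp (-(z.im ^ 2) / 4) * Real.exp (-(z.re ^ 2) / 4) := by
    rw [← Real.exp_add]; congr 1; ring
  rw [this]
  have : Real.sqrt Real.pi ≠ 0 := by positivity
  field_simp

theorem sqrt_cast_ne_zero {x : ℝ} (hx : 0 < x) : ((Real.sqrt x : ℝ) : ℂ) ≠ 0 :=
  Complex.ofReal_ne_zero.2 (Real.sqrt_pos.2 hx).ne'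

/-- `Φ_{k,l}` has angular degree `l - k`. The Gaussian is radial, and in the ladder relations
multiplication by `z` or `z̄` changes the degree exactly as the indices do. Powers of `σ` stand on
both sides to avoid a negative exponent. -/
theorem specialHermite₁_rotate (k l : ℕ) {σ : ℂ} (hσ : ‖σ‖ = 1) (z : ℂ) :
    σ ^ k * specialHermite₁ k l (σ * z) = σ ^ l * specialHermite₁ k l z := by
  induction l generalizing k with
  | zero =>
    induction k with
    | zero => simp [specialHermite₁_zero_zero, hσ]
    | succ k ih =>
      have h1 := specialHermite₁_succ_left k 0 z
      have h2 := specialHermite₁_succ_left k 0 (σ * z)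
      have hc : σ * (starRingEnd ℂ) σ = 1 := by rw [Complex.mul_conj, Complex.normSq_eq_norm_sq, hσ]; simp
      rw [map_mul] at h2
      simp only [Nat.cast_zero, mul_zero, Real.sqrt_zero, Complex.ofReal_zero, zero_mul,
        zero_add] at h1 h2
      apply mul_left_cancel₀ (sqrt_cast_ne_zero (x := 2 * k + 2) (by positivity))
      linear_combination σ ^ (k + 1) * h2 - σ ^ 0 * h1 + Complex.I * (starRingEnd ℂ) z * ih +
        Complex.I * (starRingEnd ℂ) z * specialHermite₁ k 0 (σ * z) * σ ^ k * hc
  | succ l ih =>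
    have h1 := specialHermite₁_succ_right k l z
    have h2 := specialHermite₁_succ_right k l (σ * z)
    apply mul_left_cancel₀ (sqrt_cast_ne_zero (x := 2 * l + 2) (by positivity))
    rcases k with _ | k
    · simp only [Nat.cast_zero, mul_zero, Real.sqrt_zero, Complex.ofReal_zero, zero_mul,
        zero_add] at h1 h2
      linear_combination h2 - σ ^ (l + 1) * h1 + Complex.I * σ * z * ih 0
    · simp only [Nat.add_sub_cancel] at h1 h2
      linear_combination σ ^ (k + 1) * h2 - σ ^ (l + 1) * h1 + Complex.I * σ * z * ih (k + 1) +
        (Real.sqrt (2 * (k + 1 : ℕ)) : ℂ) * σ * ih k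

/-! ### Special Hermite functions in terms of Laguerre functions -/

theorem laguerreFun_succ (k a : ℕ) (r : ℝ) :
    (k + 1) * laguerreFun (k + 1) a r =
      (k + 1 + a) * laguerreFun k a r - r ^ 2 / 2 * laguerreFun k (a + 1) r := by
  have h := congrArg (eval (r ^ 2 / 2)) (laguerrePoly_succ k a)
  simp only [eval_mul, eval_sub, eval_C, eval_X] at h
  simp only [laguerreFun]
  linear_combination Real.exp (-(r ^ 2) / 4) * h

theorem psi_succ (k a : ℕ) (r : ℝ) :
    Real.sqrt (2 * k + 2) * psi (k + 1) a r =
      Real.sqrt (2 * (k + a : ℕ) + 2) * psi k a r - r ^ 2 * psi k (a + 1) r := by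
  have h := laguerreFun_succ k a r
  have e1 : Real.sqrt (2 * k + 2) * Real.sqrt ((k + 1).factorial / (2 ^ a * (k + 1 + a).factorial))
      * Real.sqrt (2 * (k + a : ℕ) + 2) = 2 * (k + 1) *
      Real.sqrt (k.factorial / (2 ^ a * (k + a).factorial)) := by
    rw [← Real.sqrt_mul (by positivity), ← Real.sqrt_mul (by positivity),
      show (2 * (k + 1) : ℝ) = Real.sqrt ((2 * (k + 1)) ^ 2) from (Real.sqrt_sq (by positivity)).symm,
      ← Real.sqrt_mul (by positivity)]
    congr 1
    rw [Nat.factorial_succ, show k + 1 + a = (k + a) + 1 by ring, Nat.factorial_succ]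
    have : ((k + a).factorial : ℝ) ≠ 0 := by positivity
    push_cast
    field_simp
  have e2 : Real.sqrt (k.factorial / (2 ^ (a + 1) * (k + (a + 1)).factorial)) *
      Real.sqrt (2 * (k + a : ℕ) + 2) = Real.sqrt (k.factorial / (2 ^ a * (k + a).factorial)) := by
    rw [← Real.sqrt_mul (by positivity)]
    congr 1
    rw [show k + (a + 1) = (k + a) + 1 by ring, Nat.factorial_succ]
    have : ((k + a).factorial : ℝ) ≠ 0 := by positivity
    push_cast
    field_simp
    ring
  have h3 : Real.sqrt (2 * (k + a : ℕ) + 2) * Real.sqrt (2 * (k + a : ℕ) + 2) =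
      2 * (k + a : ℕ) + 2 := Real.mul_self_sqrt (by positivity)
  have hne : Real.sqrt (2 * (k + a : ℕ) + 2) ≠ 0 := by positivity
  apply mul_right_cancel₀ hne
  simp only [psi]
  push_cast at h3 ⊢
  push_cast at e1 e2
  linear_combination laguerreFun (k + 1) a r * e1 + r ^ 2 * laguerreFun k (a + 1) r * e2
    - Real.sqrt (k.factorial / (2 ^ a * (k + a).factorial)) * laguerreFun k a r * h3
    + 2 * Real.sqrt (k.factorial / (2 ^ a * (k + a).factorial)) * h

/-- For `k = 0`, raising the second index multiplies by `iz`, with matching normalization. For the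
step in `k`, the left ladder relation contains `i z̄ · i^{a+1} z^{a+1} = -i^a z^a |z|²`, and so
becomes the Laguerre recurrence `psi_succ`. -/
theorem specialHermite₁_eq_psi (k a : ℕ) (z : ℂ) :
    specialHermite₁ k (k + a) z =
      ((Real.sqrt (2 * Real.pi))⁻¹ : ℝ) * Complex.I ^ a * (z ^ a * psi k a ‖z‖) := by
  induction k generalizing a with
  | zero =>
    induction a with
    | zero =>
      simp [specialHermite₁_zero_zero, psi, laguerreFun, laguerrePoly_zero]
    | succ a ih =>
      have h1 := specialHermite₁_succ_right 0 (0 + a) z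
      have e2 : Real.sqrt (2 * (a + 1)) * psi 0 (a + 1) ‖z‖ = psi 0 a ‖z‖ := by
        simp only [psi, laguerreFun, laguerrePoly_zero, ← mul_assoc]
        rw [← Real.sqrt_mul (by positivity)]
        congr 3
        rw [show 0 + (a + 1) = (0 + a) + 1 by ring, Nat.factorial_succ]
        have : ((0 + a).factorial : ℝ) ≠ 0 := by positivity
        push_cast
        field_simp
        ring
      have e2' := congrArg (fun t : ℝ => (t : ℂ)) e2
      push_cast at e2'
      apply mul_left_cancel₀ (sqrt_cast_ne_zero (x := 2 * (0 + a : ℕ) + 2) (by positivity))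
      rw [← add_assoc, h1, ih]
      simp only [Nat.cast_zero, mul_zero, Real.sqrt_zero, Complex.ofReal_zero, zero_mul,
        zero_add]
      rw [show (2 * a + 2 : ℝ) = 2 * (a + 1) by ring]
      linear_combination (-(((Real.sqrt (2 * Real.pi))⁻¹ : ℝ) : ℂ) * Complex.I ^ (a + 1) *
        z ^ (a + 1)) * e2'
  | succ k ih =>
    have h1 := specialHermite₁_succ_left k (k + a + 1) z
    rw [Nat.add_sub_cancel, ih, show k + a + 1 = k + (a + 1) by ring, ih] at h1
    rw [show k + 1 + a = k + (a + 1) by ring]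
    have e := congrArg (fun t : ℝ => (t : ℂ)) (psi_succ k a ‖z‖)
    rw [show (2 * (k + a : ℕ) + 2 : ℝ) = 2 * (k + (a + 1) : ℕ) by push_cast; ring] at e
    have hz : z * (starRingEnd ℂ) z = (‖z‖ : ℂ) ^ 2 := Complex.mul_conj' z
    apply mul_left_cancel₀ (sqrt_cast_ne_zero (x := 2 * k + 2) (by positivity))
    rw [h1]
    simp only [Complex.ofReal_mul, Complex.ofReal_sub, Complex.ofReal_pow] at e
    have hI := Complex.I_sq
    linear_combination (-(((Real.sqrt (2 * Real.pi))⁻¹ : ℝ) : ℂ) * Complex.I ^ a * z ^ a) * e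
      + (((Real.sqrt (2 * Real.pi))⁻¹ : ℝ) : ℂ) * Complex.I ^ (a + 2) * z ^ a *
        (psi k (a + 1) ‖z‖ : ℂ) * hz + (((Real.sqrt (2 * Real.pi))⁻¹ : ℝ) : ℂ) * Complex.I ^ a *
        z ^ a * (psi k (a + 1) ‖z‖ : ℂ) * (‖z‖ : ℂ) ^ 2 * hI

/-! ### Polar coordinates -/

/-- The measure on angles used for polar coordinates. -/
def angleMeasure : Measure ℝ := volume.restrict (Set.Ioo (-Real.pi) Real.pi)

instance : SigmaFinite angleMeasure := by unfold angleMeasure; infer_instance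

theorem angleMeasure_univ : angleMeasure Set.univ = ENNReal.ofReal (2 * Real.pi) := by
  rw [angleMeasure, Measure.restrict_apply_univ, Real.volume_Ioo]
  congr 1; ring

/-- The polar coordinate parametrization `(r, θ) ↦ r e^{iθ}`. -/
def polarMap (q : ℝ × ℝ) : ℂ := q.1 * Complex.exp (q.2 * Complex.I)

theorem measurable_polarMap : Measurable polarMap := by
  unfold polarMap; fun_prop

theorem measurePreserving_polarMap :
    MeasurePreserving polarMap ((radialMeasure 0).prod angleMeasure) volume := by
  refine ⟨measurable_polarMap, ?_⟩
  ext s hs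
  rw [Measure.map_apply measurable_polarMap hs, ← lintegral_indicator_one hs,
    ← lintegral_indicator_one (measurable_polarMap hs), ← Complex.lintegral_comp_polarCoord_symm,
    polarCoord_target, Measure.volume_eq_prod, ← Measure.prod_restrict, radialMeasure,
    angleMeasure, prod_withDensity_left (by fun_prop), lintegral_withDensity_eq_lintegral_mul _
      (by fun_prop) ((measurable_one.indicator (measurable_polarMap hs)))]
  refine lintegral_congr fun q => ?_
  have hq : Complex.polarCoord.symm q = polarMap q := by
    rw [polarMap, Complex.polarCoord_symm_apply, Complex.exp_mul_I]; simp
  simp only [Pi.mul_apply, mul_zero, zero_add, pow_one, smul_eq_mul, hq]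
  rfl

theorem radialMeasure_eq_withDensity (a : ℕ) :
    radialMeasure a = (radialMeasure 0).withDensity fun r => ENNReal.ofReal (r ^ (2 * a)) := by
  rw [radialMeasure, radialMeasure, ← withDensity_mul _ (by fun_prop) (by fun_prop)]
  refine withDensity_congr_ae ?_
  filter_upwards [ae_restrict_mem measurableSet_Ioi] with r hr
  have hr' : (0 : ℝ) < r := hr
  rw [Pi.mul_apply, ← ENNReal.ofReal_mul (by positivity)]
  congr 1; ring

theorem ae_radialMeasure_pos (a : ℕ) : ∀ᵐ r ∂radialMeasure a, 0 < r :=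
  (withDensity_absolutelyContinuous _ _).ae_le (ae_restrict_mem measurableSet_Ioi)

/-- The measure `(2π)⁻¹ |z|^{2a} dz` on `ℂ`, whose image under `|·|` is `r^{2a+1} dr`. -/
def weightMeasure (a : ℕ) : Measure ℂ :=
  volume.withDensity fun z => ENNReal.ofReal (‖z‖ ^ (2 * a) / (2 * Real.pi))

instance (a : ℕ) : SigmaFinite (weightMeasure a) := by
  unfold weightMeasure; infer_instance

theorem measurePreserving_norm (a : ℕ) :
    MeasurePreserving (fun z : ℂ => ‖z‖) (weightMeasure a) (radialMeasure a) := by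
  refine ⟨measurable_norm, ?_⟩
  ext s hs
  have hpi : (0 : ℝ) < 2 * Real.pi := by positivity
  rw [Measure.map_apply measurable_norm hs, weightMeasure,
    withDensity_apply _ (measurable_norm hs), ← lintegral_indicator (measurable_norm hs),
    ← measurePreserving_polarMap.lintegral_comp
      (Measurable.indicator (by fun_prop) (measurable_norm hs)),
    radialMeasure_eq_withDensity a, withDensity_apply _ hs, ← lintegral_indicator hs]
  have h : ∀ᵐ q ∂(radialMeasure 0).prod angleMeasure,
      ((fun z : ℂ => ‖z‖) ⁻¹' s).indicator
        (fun z => ENNReal.ofReal (‖z‖ ^ (2 * a) / (2 * Real.pi))) (polarMap q) =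
      s.indicator (fun r => ENNReal.ofReal (r ^ (2 * a))) q.1 *
        (ENNReal.ofReal (2 * Real.pi))⁻¹ := by
    have : ∀ᵐ q ∂(radialMeasure 0).prod angleMeasure, 0 < q.1 :=
      Measure.quasiMeasurePreserving_fst.ae (ae_radialMeasure_pos 0)
    filter_upwards [this] with q hq
    have hn : ‖polarMap q‖ = q.1 := by
      rw [polarMap, norm_mul, Complex.norm_exp_ofReal_mul_I, mul_one, Complex.norm_real,
        Real.norm_eq_abs, abs_of_pos hq]
    by_cases hqs : q.1 ∈ s
    · rw [Set.indicator_of_mem hqs, Set.indicator_of_mem (by simpa [hn] using hqs), hn,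
        ENNReal.ofReal_div_of_pos hpi, div_eq_mul_inv]
    · rw [Set.indicator_of_notMem hqs, Set.indicator_of_notMem (by simpa [hn] using hqs), zero_mul]
  rw [lintegral_congr_ae h, lintegral_prod_mul
    (Measurable.aemeasurable (Measurable.indicator (by fun_prop) hs)) aemeasurable_const,
    lintegral_const, angleMeasure_univ, ENNReal.inv_mul_cancel (by simpa using hpi) ENNReal.ofReal_ne_top,
    mul_one]

/-! ### Passing to moduli in `n` variables -/

theorem lintegral_fin_prod_eq_prod {n : ℕ} {E : Type*} [MeasurableSpace E]
    (μ : Fin n → Measure E) [∀ i, SigmaFinite (μ i)] (f : Fin n → E → ℝ≥0∞)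
    (hf : ∀ i, Measurable (f i)) :
    ∫⁻ x : Fin n → E, ∏ i, f i (x i) ∂Measure.pi μ = ∏ i, ∫⁻ x, f i x ∂μ i := by
  induction n with
  | zero => simp
  | succ n ih =>
    have hm : ∀ i, Measurable fun x : Fin (n + 1) → E => f i (x i) :=
      fun i => (hf i).comp (measurable_pi_apply i)
    rw [← (measurePreserving_piFinSuccAbove μ 0).symm.lintegral_comp
      (Finset.measurable_fun_prod _ fun i _ => hm i), Fin.prod_univ_succ, ← ih _ _ fun i => hf _,
      ← lintegral_prod_mul (hf 0).aemeasurable (Measurable.aemeasurable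
        (Finset.measurable_fun_prod Finset.univ fun (i : Fin n) _ =>
          show Measurable fun x : Fin n → E => f i.succ (x i) from
            (hf _).comp (measurable_pi_apply i)))]
    refine lintegral_congr fun x => ?_
    simp [Fin.prod_univ_succ, MeasurableEquiv.piFinSuccAbove, Fin.insertNthEquiv]

theorem pi_withDensity {n : ℕ} {E : Type*} [MeasurableSpace E] (μ : Measure E) [SigmaFinite μ]
    (f : Fin n → E → ℝ≥0∞) (hf : ∀ i, Measurable (f i))
    [∀ i, SigmaFinite (μ.withDensity (f i))] :
    Measure.pi (fun i => μ.withDensity (f i)) =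
      (Measure.pi fun _ : Fin n => μ).withDensity fun x => ∏ i, f i (x i) := by
  refine Measure.pi_eq fun s hs => ?_
  rw [withDensity_apply _ (MeasurableSet.univ_pi hs), ← lintegral_indicator
    (MeasurableSet.univ_pi hs)]
  have : ∀ i, (μ.withDensity (f i)) (s i) = ∫⁻ x, (s i).indicator (f i) x ∂μ := by
    intro i
    rw [withDensity_apply _ (hs i), lintegral_indicator (hs i)]
  simp only [this]
  rw [← lintegral_fin_prod_eq_prod (fun _ => μ) _ fun i => (hf i).indicator (hs i)]
  refine lintegral_congr fun x => ?_
  by_cases hx : x ∈ Set.univ.pi s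
  · rw [Set.indicator_of_mem hx]
    exact Finset.prod_congr rfl fun i _ => (Set.indicator_of_mem (hx i trivial) _).symm
  · rw [Set.indicator_of_notMem hx]
    simp only [Set.mem_pi, Set.mem_univ, true_imp_iff, not_forall] at hx
    obtain ⟨i, hi⟩ := hx
    exact (Finset.prod_eq_zero (Finset.mem_univ i) (Set.indicator_of_notMem hi _)).symm

variable {n : ℕ}

/-- The map `z ↦ (|z_1|, …, |z_n|)`. -/
def absMap (z : Fin n → ℂ) : Fin n → ℝ := fun i => ‖z i‖

/-- The density of the product of the measures `(2π)⁻¹ |z_i|^{2m_i} dz_i`. -/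
def liftDensity (m : Fin n → ℕ) (z : Fin n → ℂ) : ℝ≥0∞ :=
  ∏ i, ENNReal.ofReal (‖z i‖ ^ (2 * m i) / (2 * Real.pi))

theorem measurable_liftDensity (m : Fin n → ℕ) : Measurable (liftDensity m) := by
  unfold liftDensity; fun_prop

theorem measurePreserving_absMap (m : Fin n → ℕ) :
    MeasurePreserving absMap (volume.withDensity (liftDensity m)) (muMeasure m) := by
  have h := measurePreserving_pi (fun i => weightMeasure (m i)) (fun i => radialMeasure (m i))
    (fun i => measurePreserving_norm (m i))
  have h2 := pi_withDensity (volume : Measure ℂ)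
    (fun i (z : ℂ) => ENNReal.ofReal (‖z‖ ^ (2 * m i) / (2 * Real.pi))) (fun i => by fun_prop)
  have h3 : volume.withDensity (liftDensity m) = Measure.pi fun i => weightMeasure (m i) := h2.symm
  rw [h3]
  exact h

theorem ae_coord_ne_zero : ∀ᵐ z : Fin n → ℂ, ∀ i, z i ≠ 0 := by
  rw [ae_all_iff]
  intro i
  exact (Measure.quasiMeasurePreserving_eval (fun _ : Fin n => (volume : Measure ℂ)) i).ae
    (Measure.ae_ne volume 0)

/-- The density vanishes only where some coordinate is zero, a Lebesgue null set. Hence properties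
holding `μ_m`-almost everywhere pull back to Lebesgue almost every `z`. -/
theorem quasiMeasurePreserving_absMap (m : Fin n → ℕ) :
    Measure.QuasiMeasurePreserving absMap (volume : Measure (Fin n → ℂ)) (muMeasure m) := by
  refine (measurePreserving_absMap m).quasiMeasurePreserving.mono_left ?_
  refine withDensity_absolutelyContinuous' (measurable_liftDensity m).aemeasurable ?_
  filter_upwards [ae_coord_ne_zero] with z hz
  refine Finset.prod_ne_zero_iff.2 fun i _ => ?_
  have : 0 < ‖z i‖ := norm_pos_iff.2 (hz i)
  simpa using (by positivity : 0 < ‖z i‖ ^ (2 * m i) / (2 * Real.pi))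

theorem lintegral_liftDensity_mul (m : Fin n → ℕ) {F : (Fin n → ℝ) → ℝ≥0∞}
    (hF : AEMeasurable F (muMeasure m)) :
    ∫⁻ z, liftDensity m z * F (absMap z) = ∫⁻ r, F r ∂muMeasure m := by
  have h := measurePreserving_absMap m
  rw [← h.map_eq, lintegral_map' (h.map_eq.symm ▸ hF) h.aemeasurable,
    lintegral_withDensity_eq_lintegral_mul₀ (g := fun z => F (absMap z))
    (measurable_liftDensity m).aemeasurable
    (hF.comp_quasiMeasurePreserving (quasiMeasurePreserving_absMap m))]
  rfl

/-- A polyradial function that is a.e. equal to a measurable function is a.e. a measurable function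
of the moduli. -/
theorem exists_measurable_of_polyradial {f h : (Fin n → ℂ) → ℂ} (hf : Polyradial f)
    (hh : StronglyMeasurable h) (hfh : ∀ᵐ z, h z = f z) :
    ∃ F : (Fin n → ℝ) → ℂ, StronglyMeasurable F ∧ ∀ᵐ z : Fin n → ℂ, f z = F (absMap z) := by
  have h1 := measurePreserving_pi (fun _ : Fin n => (radialMeasure 0).prod angleMeasure)
    (fun _ => (volume : Measure ℂ)) (fun _ => measurePreserving_polarMap)
  have h2 := h1.quasiMeasurePreserving.ae hfh
  have h3 := (measurePreserving_arrowProdEquivProdArrow ℝ ℝ (Fin n) (fun _ => radialMeasure 0)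
    (fun _ => angleMeasure)).symm.quasiMeasurePreserving.ae h2
  have h4 := Measure.ae_ae_of_ae_prod
    (Measure.measurePreserving_swap.quasiMeasurePreserving.ae h3)
  -- Fubini gives, for almost every tuple of angles, equality for almost every tuple of radii. The
  -- angle measure is nonzero, so one good tuple `θ` can be fixed, and the measurable function along
  -- that slice represents `f`.
  have : (ae (Measure.pi fun _ : Fin n => angleMeasure)).NeBot := by
    rw [ae_neBot]
    intro h0
    have := congrArg (fun μ : Measure (Fin n → ℝ) => μ Set.univ) h0
    simp only [Measure.pi_univ, angleMeasure_univ, Measure.coe_zero, Pi.zero_apply,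
      Finset.prod_eq_zero_iff, ENNReal.ofReal_eq_zero] at this
    obtain ⟨_, _, h⟩ := this
    linarith [Real.pi_pos]
  obtain ⟨θ, hθ⟩ := h4.exists
  refine ⟨fun r => h fun i => polarMap (r i, θ i), hh.comp_measurable ?_, ?_⟩
  · exact measurable_pi_lambda _ fun i => measurable_polarMap.comp (by fun_prop)
  · have h5 := (quasiMeasurePreserving_absMap (0 : Fin n → ℕ)).ae hθ
    filter_upwards [h5] with z hz
    have e : f (fun i => polarMap (absMap z i, θ i)) = f z := by
      have e1 := hf (fun i => Complex.exp (θ i * Complex.I))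
        (fun i => Complex.norm_exp_ofReal_mul_I _) (fun i => (‖z i‖ : ℂ))
      -- This diagonal unitary rotates `|z|` to `z`. At a zero coordinate any unimodular entry would
      -- do.
      have e2 := hf (fun i => if z i = 0 then 1 else z i / ‖z i‖)
        (fun i => by
          split_ifs with hi
          · simp
          · simp [hi]) (fun i => (‖z i‖ : ℂ))
      have e3 : (fun i => (if z i = 0 then 1 else z i / ‖z i‖) * (‖z i‖ : ℂ)) = z := by
        ext i
        split_ifs with hi
        · simp [hi]
        · have : (‖z i‖ : ℂ) ≠ 0 := by simpa using hi
          field_simp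
      rw [e3] at e2
      rw [e2, ← e1]
      congr 1; ext i
      rw [polarMap, absMap, mul_comm]
    rw [← e]
    exact hz.symm

/-! ### Lifting functions from `ℝ_+^n` to `ℂ^n` -/

/-- A measurable weight on `ℂ^n` with the modulus of `(2π)^{-n/2} z^m`. -/
structure IsLiftWeight (m : Fin n → ℕ) (w : (Fin n → ℂ) → ℂ) : Prop where
  measurable : Measurable w
  norm_eq : ∀ z, ‖w z‖ = ∏ i, (Real.sqrt (2 * Real.pi))⁻¹ * ‖z i‖ ^ m i

theorem IsLiftWeight.enorm_sq {m : Fin n → ℕ} {w : (Fin n → ℂ) → ℂ} (hw : IsLiftWeight m w)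
    (z : Fin n → ℂ) : ‖w z‖ₑ ^ (2 : ℝ) = liftDensity m z := by
  rw [← ofReal_norm, hw.norm_eq, ENNReal.ofReal_rpow_of_nonneg (by positivity) (by norm_num),
    liftDensity, ← ENNReal.ofReal_prod_of_nonneg (fun i _ => by positivity), Real.rpow_two,
    ← Finset.prod_pow]
  congr 1
  refine Finset.prod_congr rfl fun i _ => ?_
  rw [mul_pow, inv_pow, Real.sq_sqrt (by positivity), ← pow_mul, mul_comm (m i) 2]
  field_simp

theorem IsLiftWeight.aestronglyMeasurable {m : Fin n → ℕ} {w : (Fin n → ℂ) → ℂ}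
    (hw : IsLiftWeight m w) {f : (Fin n → ℝ) → ℂ} (hf : AEStronglyMeasurable f (muMeasure m)) :
    AEStronglyMeasurable (fun z => w z * f (absMap z)) volume :=
  hw.measurable.aestronglyMeasurable.mul
    (hf.comp_quasiMeasurePreserving (quasiMeasurePreserving_absMap m))

theorem IsLiftWeight.eLpNorm_eq {m : Fin n → ℕ} {w : (Fin n → ℂ) → ℂ} (hw : IsLiftWeight m w)
    {f : (Fin n → ℝ) → ℂ} (hf : AEStronglyMeasurable f (muMeasure m)) :
    eLpNorm (fun z => w z * f (absMap z)) 2 volume = eLpNorm f 2 (muMeasure m) := by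
  rw [eLpNorm_eq_lintegral_rpow_enorm_toReal two_ne_zero ENNReal.ofNat_ne_top,
    eLpNorm_eq_lintegral_rpow_enorm_toReal two_ne_zero ENNReal.ofNat_ne_top,
    ← lintegral_liftDensity_mul m (hf.enorm.pow_const _)]
  simp only [enorm_mul, ENNReal.toReal_ofNat]
  congr 1
  refine lintegral_congr fun z => ?_
  rw [ENNReal.mul_rpow_of_nonneg _ _ zero_le_two, hw.enorm_sq]

theorem IsLiftWeight.memLp {m : Fin n → ℕ} {w : (Fin n → ℂ) → ℂ} (hw : IsLiftWeight m w)
    {f : (Fin n → ℝ) → ℂ} (hf : MemLp f 2 (muMeasure m)) :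
    MemLp (fun z => w z * f (absMap z)) 2 volume :=
  ⟨hw.aestronglyMeasurable hf.1, by rw [hw.eLpNorm_eq hf.1]; exact hf.2⟩

/-- The isometry `f ↦ w(z) f(|z_1|, …, |z_n|)` from `L²(dμ_m)` to `L²(ℂ^n)`. -/
def lift {m : Fin n → ℕ} {w : (Fin n → ℂ) → ℂ} (hw : IsLiftWeight m w) :
    Lp ℂ 2 (muMeasure m) →ₗᵢ[ℂ] Lp ℂ 2 (volume : Measure (Fin n → ℂ)) where
  toFun f := (hw.memLp (Lp.memLp f)).toLp
  map_add' f g := by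
    rw [← MemLp.toLp_add]
    refine MemLp.toLp_congr _ _ ?_
    filter_upwards [(quasiMeasurePreserving_absMap m).ae (Lp.coeFn_add f g)] with z hz
    simp only [Pi.add_apply] at hz ⊢
    rw [hz, mul_add]
  map_smul' c f := by
    rw [RingHom.id_apply, ← MemLp.toLp_const_smul]
    refine MemLp.toLp_congr _ _ ?_
    filter_upwards [(quasiMeasurePreserving_absMap m).ae (Lp.coeFn_smul c f)] with z hz
    simp only [Pi.smul_apply, smul_eq_mul] at hz ⊢
    rw [hz]; ring
  norm_map' f := by
    change ‖(hw.memLp (Lp.memLp f)).toLp‖ = ‖f‖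
    rw [Lp.norm_toLp, hw.eLpNorm_eq (Lp.aestronglyMeasurable f), Lp.norm_def]

theorem coeFn_lift {m : Fin n → ℕ} {w : (Fin n → ℂ) → ℂ} (hw : IsLiftWeight m w)
    (f : Lp ℂ 2 (muMeasure m)) : lift hw f =ᵐ[volume] fun z => w z * f (absMap z) :=
  (hw.memLp (Lp.memLp f)).coeFn_toLp

theorem coeFn_lift_toLp {m : Fin n → ℕ} {w : (Fin n → ℂ) → ℂ} (hw : IsLiftWeight m w)
    {f : (Fin n → ℝ) → ℂ} (hf : MemLp f 2 (muMeasure m)) :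
    lift hw hf.toLp =ᵐ[volume] fun z => w z * f (absMap z) := by
  filter_upwards [coeFn_lift hw hf.toLp, (quasiMeasurePreserving_absMap m).ae hf.coeFn_toLp]
    with z h1 h2
  rw [h1, h2]

theorem weightedIntegral_congr {p : ℝ} {m : Fin n → ℕ} {g h : (Fin n → ℂ) → ℂ}
    (hgh : g =ᵐ[volume] h) : weightedIntegral p m g = weightedIntegral p m h := by
  refine lintegral_congr_ae ?_
  filter_upwards [hgh] with z hz
  rw [hz]

/-- In each coordinate the exponents add up as `m_i p + m_i (2 - p) = 2 m_i`, which is the density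
that pushes forward to `μ_m`. The constant collects the `p`-th power of `(2π)^{-1/2}` against the
factor `(2π)^{-1}` of that density. Only `|w|` enters, so `U` and `V` share the constant. -/
theorem weightedIntegral_lift {p : ℝ} (hp : 0 < p) {m : Fin n → ℕ} {w : (Fin n → ℂ) → ℂ}
    (hw : IsLiftWeight m w) (f : Lp ℂ 2 (muMeasure m)) :
    weightedIntegral p m (lift hw f) =
      ENNReal.ofReal ((Real.sqrt (2 * Real.pi) ^ (2 - p)) ^ n) *
        ∫⁻ r, ‖f r‖ₑ ^ p ∂muMeasure m := by
  have hm := (Lp.aestronglyMeasurable f).enorm.pow_const p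
  rw [weightedIntegral_congr (coeFn_lift hw f), ← lintegral_liftDensity_mul m hm,
    ← lintegral_const_mul' _ _ ENNReal.ofReal_ne_top, weightedIntegral]
  refine lintegral_congr_ae ?_
  filter_upwards [ae_coord_ne_zero] with z hz
  have hs : (0 : ℝ) < Real.sqrt (2 * Real.pi) := by positivity
  rw [liftDensity, ← ENNReal.ofReal_prod_of_nonneg (fun i _ => by positivity), ← ofReal_norm,
    ENNReal.ofReal_rpow_of_nonneg (norm_nonneg _) hp.le, ← ENNReal.ofReal_mul (by positivity),
    ← ENNReal.ofReal_mul (by positivity)]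
  congr 1
  rw [norm_mul, hw.norm_eq, Real.mul_rpow (by positivity) (norm_nonneg _),
    ← Real.finsetProd_rpow _ _ (fun i _ => by positivity)]
  have key : (∏ i, ((Real.sqrt (2 * Real.pi))⁻¹ * ‖z i‖ ^ m i) ^ p) *
      ∏ i, ‖z i‖ ^ ((m i : ℝ) * (2 - p)) = (Real.sqrt (2 * Real.pi) ^ (2 - p)) ^ n *
      ∏ i, ‖z i‖ ^ (2 * m i) / (2 * Real.pi) := by
    have : (Real.sqrt (2 * Real.pi) ^ (2 - p)) ^ n =
        ∏ _i : Fin n, Real.sqrt (2 * Real.pi) ^ (2 - p) := by simp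
    rw [this, ← Finset.prod_mul_distrib, ← Finset.prod_mul_distrib]
    refine Finset.prod_congr rfl fun i _ => ?_
    have hzi : 0 < ‖z i‖ := norm_pos_iff.2 (hz i)
    rw [Real.mul_rpow (by positivity) (by positivity), Real.inv_rpow hs.le, Real.rpow_sub hs,
      Real.rpow_two, Real.sq_sqrt (by positivity), ← Real.rpow_natCast, ← Real.rpow_mul hzi.le,
      mul_assoc, ← Real.rpow_add hzi, ← Real.rpow_natCast ‖z i‖ (2 * m i),
      show (m i : ℝ) * p + m i * (2 - p) = ((2 * m i : ℕ) : ℝ) by push_cast; ring]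
    field_simp
  linear_combination ‖f (absMap z)‖ ^ p * key

/-- The weight `(2π)^{-n/2} z^m`. -/
def monomialWeight (m : Fin n → ℕ) (z : Fin n → ℂ) : ℂ :=
  ∏ i, ((Real.sqrt (2 * Real.pi))⁻¹ : ℝ) * z i ^ m i

theorem isLiftWeight_monomialWeight (m : Fin n → ℕ) : IsLiftWeight m (monomialWeight m) where
  measurable := by unfold monomialWeight; fun_prop
  norm_eq z := by
    simp only [monomialWeight, norm_prod, norm_mul, norm_pow, Complex.norm_real, norm_inv,
      Real.norm_eq_abs, abs_of_nonneg (Real.sqrt_nonneg _)]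

open Classical in
/-- The weight `(2π)^{-n/2} z^m z_j / |z_j|`. -/
def phaseWeight (j : Fin n) (m : Fin n → ℕ) (z : Fin n → ℂ) : ℂ :=
  (if z j = 0 then 1 else z j / ‖z j‖) * monomialWeight m z

/-- The value `1` at `z_j = 0` keeps the phase unimodular, so the modulus is right at every point.
-/
theorem isLiftWeight_phaseWeight (j : Fin n) (m : Fin n → ℕ) :
    IsLiftWeight m (phaseWeight j m) where
  measurable := by
    refine Measurable.mul (Measurable.ite ?_ measurable_const (by fun_prop))
      (isLiftWeight_monomialWeight m).measurable
    exact measurableSet_eq_fun (by fun_prop) measurable_const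
  norm_eq z := by
    rw [phaseWeight, norm_mul, (isLiftWeight_monomialWeight m).norm_eq]
    split_ifs with h
    · simp
    · simp [h]

/-- The isometry `f ↦ (2π)^{-n/2} z^m f(|z|)`. -/
abbrev monomialLift (m : Fin n → ℕ) := lift (isLiftWeight_monomialWeight m)

/-- The isometry `f ↦ (2π)^{-n/2} z^m (z_j / |z_j|) f(|z|)`. -/
abbrev phaseLift (j : Fin n) (m : Fin n → ℕ) := lift (isLiftWeight_phaseWeight j m)

theorem monomialWeight_eq (m : Fin n → ℕ) (z : Fin n → ℂ) :
    monomialWeight m z =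
      (((Real.sqrt (2 * Real.pi))⁻¹ : ℝ) : ℂ) ^ n * ∏ i, z i ^ m i := by
  simp [monomialWeight, Finset.prod_mul_distrib]

theorem isHomogeneous_monomialLift (m : Fin n → ℕ) (f : Lp ℂ 2 (muMeasure m)) :
    IsHomogeneous m (monomialLift m f) := by
  refine ⟨fun z => (((Real.sqrt (2 * Real.pi))⁻¹ : ℝ) : ℂ) ^ n * f (absMap z), ?_, ?_⟩
  · intro σ hσ z
    have : absMap (fun j => σ j * z j) = absMap z := by
      ext i; simp [absMap, hσ]
    simp only [this]
  · filter_upwards [coeFn_lift (isLiftWeight_monomialWeight m) f] with z hz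
    rw [hz, monomialWeight_eq]; ring

theorem exists_monomialLift_eq {m : Fin n → ℕ} {g : Lp ℂ 2 (volume : Measure (Fin n → ℂ))}
    (hg : IsHomogeneous m g) : ∃ f, monomialLift m f = g := by
  obtain ⟨f₀, hf₀, hgf⟩ := hg
  have hprod : Measurable fun z : Fin n → ℂ => ∏ i, z i ^ m i := by fun_prop
  have hh : StronglyMeasurable fun z : Fin n → ℂ => g z / ∏ i, z i ^ m i :=
    ((Lp.stronglyMeasurable g).measurable.div hprod).stronglyMeasurable
  -- The polyradial factor need not be measurable itself, but it agrees with `g / z^m` away from the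
  -- coordinate hyperplanes.
  obtain ⟨F, hF, hfF⟩ := exists_measurable_of_polyradial hf₀ hh (by
    filter_upwards [hgf, ae_coord_ne_zero] with z h1 h2
    have : ∏ i, z i ^ m i ≠ 0 := Finset.prod_ne_zero_iff.2 fun i _ => pow_ne_zero _ (h2 i)
    rw [h1]; field_simp)
  set c : ℂ := (((Real.sqrt (2 * Real.pi))⁻¹ : ℝ) : ℂ) ^ n with hc
  have hc0 : c ≠ 0 := by
    refine pow_ne_zero _ (Complex.ofReal_ne_zero.2 (by positivity))
  have hw := isLiftWeight_monomialWeight m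
  have e : (fun z => monomialWeight m z * (c⁻¹ * F (absMap z))) =ᵐ[volume] g := by
    filter_upwards [hgf, hfF] with z h1 h2
    rw [h1, h2, monomialWeight_eq, ← hc]; field_simp
  have hm : MemLp (fun r => c⁻¹ * F r) 2 (muMeasure m) := by
    have hFm : AEStronglyMeasurable (fun r => c⁻¹ * F r) (muMeasure m) :=
      (hF.const_mul c⁻¹).aestronglyMeasurable
    refine ⟨hFm, ?_⟩
    rw [← hw.eLpNorm_eq hFm, eLpNorm_congr_ae e]
    exact Lp.eLpNorm_lt_top g
  refine ⟨hm.toLp, Lp.ext ?_⟩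
  exact (coeFn_lift_toLp hw hm).trans e

/-! ### Special Hermite functions and homogeneous functions -/

theorem specialHermiteLp_eq_lift (m α : Fin n → ℕ) :
    specialHermiteLp α (α + m) = (∏ i, Complex.I ^ m i) • monomialLift m (PsiLp m α) := by
  refine Lp.ext ?_
  filter_upwards [(memLp_specialHermite α (α + m)).coeFn_toLp,
    Lp.coeFn_smul (∏ i, Complex.I ^ m i) (monomialLift m (PsiLp m α)),
    coeFn_lift_toLp (isLiftWeight_monomialWeight m) (memLp_Psi m α)] with z h1 h2 h3
  rw [specialHermiteLp, h1, h2, Pi.smul_apply, PsiLp, h3, specialHermite, Psi_eq_prod,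
    monomialWeight, smul_eq_mul]
  push_cast
  rw [← Finset.prod_mul_distrib, ← Finset.prod_mul_distrib]
  refine Finset.prod_congr rfl fun i _ => ?_
  rw [Pi.add_apply, specialHermite₁_eq_psi, absMap]
  push_cast; ring

theorem exists_norm_one_pow_ne {a b : ℕ} (hab : a ≠ b) : ∃ s : ℂ, ‖s‖ = 1 ∧ s ^ a ≠ s ^ b := by
  wlog h : a < b generalizing a b
  · obtain ⟨s, h1, h2⟩ := this hab.symm (by omega)
    exact ⟨s, h1, h2.symm⟩
  obtain ⟨d, rfl⟩ := Nat.exists_eq_add_of_lt h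
  -- With `b - a = d + 1`, the number `s = e^{iπ/(b-a)}` satisfies `s^{b-a} = -1`.
  have hs : ‖Complex.exp (((Real.pi / (d + 1 : ℕ) : ℝ) : ℂ) * Complex.I)‖ = 1 :=
    Complex.norm_exp_ofReal_mul_I _
  refine ⟨_, hs, fun he => ?_⟩
  have hd : ((d : ℂ) + 1) ≠ 0 := by exact_mod_cast d.succ_ne_zero
  have : Complex.exp (((Real.pi / (d + 1 : ℕ) : ℝ) : ℂ) * Complex.I) ^ (d + 1) = -1 := by
    rw [← Complex.exp_nat_mul, ← Complex.exp_pi_mul_I]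
    congr 1
    push_cast
    field_simp
  rw [add_assoc, pow_add, this] at he
  have h0 : Complex.exp (((Real.pi / (d + 1 : ℕ) : ℝ) : ℂ) * Complex.I) ^ a ≠ 0 :=
    pow_ne_zero _ (Complex.exp_ne_zero _)
  exact h0 (by linear_combination (1 / 2) * he)

theorem measurePreserving_rotate {σ : Fin n → ℂ} (hσ : ∀ i, ‖σ i‖ = 1) :
    MeasurePreserving (fun (z : Fin n → ℂ) i => σ i * z i) volume volume := by
  refine measurePreserving_pi (fun _ : Fin n => (volume : Measure ℂ)) (fun _ => volume)
    fun i => ?_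
  exact (rotation ⟨σ i, by simpa [Submonoid.unitSphere] using hσ i⟩).measurePreserving

theorem specialHermite_rotate (α β : Fin n → ℕ) {σ : Fin n → ℂ} (hσ : ∀ i, ‖σ i‖ = 1)
    (z : Fin n → ℂ) : (∏ i, σ i ^ α i) * specialHermite α β (fun i => σ i * z i) =
      (∏ i, σ i ^ β i) * specialHermite α β z := by
  simp only [specialHermite, ← Finset.prod_mul_distrib]
  exact Finset.prod_congr rfl fun i _ => specialHermite₁_rotate _ _ (hσ i) _

/-- The two functions belong to different characters of the torus. Rotating a coordinate `j` with
`β_j ≠ α_j + m_j` preserves the integral of the product, yet multiplies it by a nontrivial factor.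
-/
theorem inner_specialHermiteLp_monomialLift_eq_zero {m α β : Fin n → ℕ} (h : β ≠ α + m)
    (f : Lp ℂ 2 (muMeasure m)) : inner ℂ (specialHermiteLp α β) (monomialLift m f) = 0 := by
  obtain ⟨j, hj⟩ := Function.ne_iff.1 h
  obtain ⟨s, hs, hs'⟩ := exists_norm_one_pow_ne hj
  set σ : Fin n → ℂ := Function.update 1 j s with hσdef
  have hσ : ∀ i, ‖σ i‖ = 1 := by
    intro i
    by_cases hi : i = j
    · subst hi; simp [hσdef, hs]
    · simp [hσdef, hi]
  have hprod : ∀ γ : Fin n → ℕ, ∏ i, σ i ^ γ i = s ^ γ j := by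
    intro γ
    rw [Finset.prod_eq_single j]
    · simp [hσdef]
    · intro i _ hi; simp [hσdef, hi]
    · simp
  set G : (Fin n → ℂ) → ℂ := fun z =>
    (starRingEnd ℂ) (specialHermite α β z) * (monomialWeight m z * f (absMap z)) with hG
  have hGint : inner ℂ (specialHermiteLp α β) (monomialLift m f) = ∫ z, G z := by
    rw [L2.inner_def]
    refine integral_congr_ae ?_
    filter_upwards [(memLp_specialHermite α β).coeFn_toLp,
      coeFn_lift (isLiftWeight_monomialWeight m) f] with z h1 h2
    rw [specialHermiteLp, h1, h2, hG, RCLike.inner_apply, mul_comm]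
  have hGm : AEStronglyMeasurable G volume :=
    (Complex.continuous_conj.comp_aestronglyMeasurable (memLp_specialHermite α β).1).mul
      ((isLiftWeight_monomialWeight m).aestronglyMeasurable (Lp.aestronglyMeasurable f))
  have hrot : ∀ z, s ^ β j * G (fun i => σ i * z i) = s ^ (α + m) j * G z := by
    intro z
    have h1 := congrArg (starRingEnd ℂ) (specialHermite_rotate α β hσ z)
    rw [map_mul, map_mul, hprod, hprod, map_pow, map_pow] at h1
    have h2 : monomialWeight m (fun i => σ i * z i) = s ^ m j * monomialWeight m z := by
      rw [monomialWeight_eq, monomialWeight_eq, ← hprod]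
      simp only [mul_pow, Finset.prod_mul_distrib]
      ring
    have h3 : absMap (fun i => σ i * z i) = absMap z := by
      ext i; simp [absMap, hσ]
    have hc : s * (starRingEnd ℂ) s = 1 := by
      rw [Complex.mul_conj, Complex.normSq_eq_norm_sq, hs]; simp
    have hcp : ∀ k : ℕ, s ^ k * (starRingEnd ℂ) s ^ k = 1 := by
      intro k; rw [← mul_pow, hc, one_pow]
    simp only [hG, h2, h3, Pi.add_apply, pow_add]
    linear_combination (s ^ α j * s ^ β j * s ^ m j * monomialWeight m z * f (absMap z)) * h1
      - s ^ β j * s ^ m j * monomialWeight m z * f (absMap z) *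
        (starRingEnd ℂ) (specialHermite α β (fun i => σ i * z i)) * hcp (α j)
      + s ^ α j * s ^ m j * monomialWeight m z * f (absMap z) *
        (starRingEnd ℂ) (specialHermite α β z) * hcp (β j)
  have hmp := measurePreserving_rotate hσ
  have hI : ∫ z : Fin n → ℂ, G (fun i => σ i * z i) = ∫ z, G z := by
    conv_rhs => rw [← hmp.map_eq]
    rw [integral_map hmp.aemeasurable (by rw [hmp.map_eq]; exact hGm)]
  have h4 : s ^ β j * ∫ z, G z = s ^ (α + m) j * ∫ z, G z := by
    rw [← hI, ← integral_const_mul, integral_congr_ae (Filter.Eventually.of_forall hrot),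
      integral_const_mul, hI]
  rw [hGint]
  by_contra h0
  exact hs' (mul_right_cancel₀ h0 h4)

/-! ### The action of `Z̄_j` on lifted Laguerre functions -/

/-- The function `(2π)^{-1/2} z^a ψ_k^a(|z|)` on `ℂ`. -/
def liftedPsi (k a : ℕ) (z : ℂ) : ℂ :=
  ((Real.sqrt (2 * Real.pi))⁻¹ : ℝ) * z ^ a * psi k a ‖z‖

theorem contDiff_liftedPsi (k a : ℕ) : ContDiff ℝ ∞ (liftedPsi k a) := by
  unfold liftedPsi psi laguerreFun
  have h1 : ContDiff ℝ ∞ fun z : ℂ => ‖z‖ ^ 2 := contDiff_norm_sq ℝ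
  have h2 : ContDiff ℝ ∞ fun z : ℂ => (laguerrePoly k a).eval (‖z‖ ^ 2 / 2) :=
    ((laguerrePoly k a).contDiff_aeval (𝕜 := ℝ) ∞).comp (h1.div_const 2)
  have h3 : ContDiff ℝ ∞ fun z : ℂ => Real.exp (-(‖z‖ ^ 2) / 4) :=
    (h1.neg.div_const 4).exp
  have h4 : ContDiff ℝ ∞ fun z : ℂ => z ^ a := contDiff_id.pow a
  exact (contDiff_const.mul h4).mul (Complex.ofRealCLM.contDiff.comp
    (contDiff_const.mul (h2.mul h3)))

theorem laguerre_derivative_eq_psi (k a : ℕ) (r : ℝ) :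
    Real.sqrt (k.factorial / (2 ^ a * (k + a).factorial)) *
      ((derivative (laguerrePoly k a)).eval (r ^ 2 / 2) * Real.exp (-(r ^ 2) / 4)) =
    -(Real.sqrt (2 * k) * psi (k - 1) (a + 1) r) := by
  rcases k with _ | k
  · simp [laguerrePoly_zero]
  · rw [derivative_laguerrePoly_succ, psi, laguerreFun, Nat.add_sub_cancel, ← mul_assoc
      (Real.sqrt (2 * (k + 1 : ℕ))), ← Real.sqrt_mul (by positivity), eval_neg]
    have : (((k + 1).factorial : ℕ) : ℝ) / (2 ^ a * ((k + 1 + a).factorial : ℕ)) =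
        2 * ((k + 1 : ℕ) : ℝ) * ((k.factorial : ℕ) / (2 ^ (a + 1) * ((k + (a + 1)).factorial : ℕ))) := by
      rw [Nat.factorial_succ, show k + 1 + a = k + (a + 1) by ring]
      have : ((k + (a + 1)).factorial : ℝ) ≠ 0 := by positivity
      push_cast
      field_simp
      ring
    rw [this]
    ring

/-- Here `∂_x + i∂_y = 2∂_z̄` annihilates the holomorphic factor `z^a`, and on `e^{-|z|²/4}` it
produces `-z/2`, cancelling the potential `z/2`. Only the derivative of the Laguerre polynomial is
left: it gives `z (L_k^a)'(|z|²/2)`, and `(L_k^a)' = -L_{k-1}^{a+1}`. For `k = 0` the coefficient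
vanishes. -/
theorem exists_hasFDerivAt_liftedPsi (k a : ℕ) (z : ℂ) :
    ∃ E' : ℂ →L[ℝ] ℂ, HasFDerivAt (liftedPsi k a) E' z ∧
      E' 1 + Complex.I * E' Complex.I + z / 2 * liftedPsi k a z =
        -(Real.sqrt (2 * k) * liftedPsi (k - 1) (a + 1) z) := by
  set c := Real.sqrt (k.factorial / (2 ^ a * (k + a).factorial)) with hc
  set d : ℂ := (((Real.sqrt (2 * Real.pi))⁻¹ : ℝ) : ℂ) with hd
  set L := laguerrePoly k a with hL
  have h1 : ∀ t : ℝ, HasDerivAt (fun t : ℝ => c * (L.eval (t / 2) * Real.exp (-t / 4)))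
      (c * ((derivative L).eval (t / 2) * (1 / 2) * Real.exp (-t / 4) +
        L.eval (t / 2) * (Real.exp (-t / 4) * (-1 / 4)))) t := by
    intro t
    have e1 : HasDerivAt (fun t : ℝ => t / 2) (1 / 2) t := (hasDerivAt_id t).div_const 2
    have e2 := (L.hasDerivAt (t / 2)).comp t e1
    have e3 : HasDerivAt (fun t : ℝ => Real.exp (-t / 4)) (Real.exp (-t / 4) * (-1 / 4)) t :=
      (((hasDerivAt_id t).neg).div_const 4).exp
    exact (e2.mul e3).const_mul c
  have h2 : HasFDerivAt (fun z : ℂ => ‖z‖ ^ 2) (2 • innerSL ℝ z) z :=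
    (hasStrictFDerivAt_norm_sq z).hasFDerivAt
  have h3 := Complex.ofRealCLM.hasFDerivAt.comp z ((h1 (‖z‖ ^ 2)).comp_hasFDerivAt z h2)
  have h4 := ((hasDerivAt_pow a z).hasFDerivAt.restrictScalars ℝ).const_mul d
  have h5 := h4.mul h3
  refine ⟨_, h5, ?_⟩
  have hψ := congrArg (fun t : ℝ => (t : ℂ)) (laguerre_derivative_eq_psi k a ‖z‖)
  have hz := Complex.re_add_im z
  have e1 : liftedPsi k a z = d * z ^ a *
      ((c * (L.eval (‖z‖ ^ 2 / 2) * Real.exp (-(‖z‖ ^ 2) / 4)) : ℝ) : ℂ) := rfl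
  have e2 : liftedPsi (k - 1) (a + 1) z = d * z ^ (a + 1) * psi (k - 1) (a + 1) ‖z‖ := rfl
  rw [e1, e2]
  rw [← hc, ← hL] at hψ
  clear_value c d L
  generalize Real.sqrt (2 * k) = s at hψ ⊢
  generalize psi (k - 1) (a + 1) ‖z‖ = q at hψ ⊢
  simp at hψ ⊢
  linear_combination (d * z ^ a * (c : ℂ) * ((((derivative L).eval (‖z‖ ^ 2 / 2) : ℝ) : ℂ) -
    ((L.eval (‖z‖ ^ 2 / 2) : ℝ) : ℂ) / 2) *
    Complex.exp (-(‖z‖ : ℂ) ^ 2 / 4)) * hz + d * z ^ (a + 1) * hψ +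
    ((c : ℂ) * (((L.eval (‖z‖ ^ 2 / 2) : ℝ) : ℂ) * Complex.exp (-(‖z‖ : ℂ) ^ 2 / 4)) * (d * (a * z ^ (a - 1)))) *
      Complex.I_mul_I

/-- The function `(2π)^{-n/2} z^m Ψ_α^m(|z|)` on `ℂ^n`. -/
def liftedPsiProd (m α : Fin n → ℕ) (z : Fin n → ℂ) : ℂ := ∏ i, liftedPsi (α i) (m i) (z i)

theorem contDiff_liftedPsiProd (m α : Fin n → ℕ) : ContDiff ℝ ∞ (liftedPsiProd m α) :=
  contDiff_prod fun i _ => (contDiff_liftedPsi _ _).comp (contDiff_apply ℝ ℂ i)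

theorem zbar_liftedPsiProd (j : Fin n) (m α : Fin n → ℕ) (z : Fin n → ℂ) :
    fderiv ℝ (liftedPsiProd m α) z (Pi.single j 1) +
      Complex.I * fderiv ℝ (liftedPsiProd m α) z (Pi.single j Complex.I) +
      z j / 2 * liftedPsiProd m α z =
    -(Real.sqrt (2 * α j) * liftedPsiProd (m + Pi.single j 1) (α - Pi.single j 1) z) := by
  choose E' hE' hE using fun i => exists_hasFDerivAt_liftedPsi (α i) (m i) (z i)
  have hc : ∀ i, HasFDerivAt (fun z : Fin n → ℂ => liftedPsi (α i) (m i) (z i))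
      ((E' i).comp (ContinuousLinearMap.proj i)) z := fun i =>
    HasFDerivAt.comp (g := liftedPsi (α i) (m i)) z (hE' i)
      (ContinuousLinearMap.proj (R := ℝ) (φ := fun _ => ℂ) i).hasFDerivAt
  have hd : fderiv ℝ (liftedPsiProd m α) z = _ :=
    (HasFDerivAt.finsetProd (u := Finset.univ) fun i _ => hc i).fderiv
  have hv : ∀ v : ℂ, fderiv ℝ (liftedPsiProd m α) z (Pi.single j v) =
      (∏ i ∈ Finset.univ.erase j, liftedPsi (α i) (m i) (z i)) * E' j v := by
    intro v
    rw [hd, sum_apply, Finset.sum_eq_single j]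
    · rw [smul_apply, ContinuousLinearMap.comp_apply,
        ContinuousLinearMap.proj_apply, Pi.single_eq_same, smul_eq_mul]
    · intro i _ hi
      rw [smul_apply, ContinuousLinearMap.comp_apply,
        ContinuousLinearMap.proj_apply, Pi.single_eq_of_ne hi, map_zero, smul_zero]
    · simp
  have h1 : liftedPsiProd m α z = liftedPsi (α j) (m j) (z j) *
      ∏ i ∈ Finset.univ.erase j, liftedPsi (α i) (m i) (z i) :=
    (Finset.mul_prod_erase _ _ (Finset.mem_univ j)).symm
  have h2 : liftedPsiProd (m + Pi.single j 1) (α - Pi.single j 1) z =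
      liftedPsi (α j - 1) (m j + 1) (z j) *
      ∏ i ∈ Finset.univ.erase j, liftedPsi (α i) (m i) (z i) := by
    rw [liftedPsiProd, ← Finset.mul_prod_erase _ _ (Finset.mem_univ j)]
    congr 1
    · simp
    · refine Finset.prod_congr rfl fun i hi => ?_
      simp [Finset.ne_of_mem_erase hi]
  rw [hv, hv, h1, h2]
  linear_combination (∏ i ∈ Finset.univ.erase j, liftedPsi (α i) (m i) (z i)) * hE j

theorem isZbar_of_contDiff {j : Fin n} {u v : Lp ℂ 2 (volume : Measure (Fin n → ℂ))}
    {u₀ : (Fin n → ℂ) → ℂ} (hu₀ : ContDiff ℝ ∞ u₀) (hu : u =ᵐ[volume] u₀)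
    (hv : v =ᵐ[volume] fun z => fderiv ℝ u₀ z (Pi.single j 1) +
      Complex.I * fderiv ℝ u₀ z (Pi.single j Complex.I) + z j / 2 * u₀ z) :
    IsZbar j u v := by
  intro φ hφ hφc
  have hcu : Continuous u₀ := hu₀.continuous
  have hcφ : Continuous φ := hφ.continuous
  have hdu : Continuous (fderiv ℝ u₀) := hu₀.continuous_fderiv (by simp)
  have hdφ : Continuous (fderiv ℝ φ) := hφ.continuous_fderiv (by simp)
  have i1 : ∀ w : Fin n → ℂ, Integrable fun z => fderiv ℝ u₀ z w * φ z := fun w =>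
    Continuous.integrable_of_hasCompactSupport (by fun_prop) hφc.mul_left
  have i2 : ∀ w : Fin n → ℂ, Integrable fun z => u₀ z * fderiv ℝ φ z w := fun w =>
    Continuous.integrable_of_hasCompactSupport (by fun_prop) (hφc.fderiv_apply ℝ w).mul_left
  have i3 : Integrable fun z => u₀ z * φ z :=
    Continuous.integrable_of_hasCompactSupport (by fun_prop) hφc.mul_left
  have i4 : Integrable fun z : Fin n → ℂ => z j / 2 * u₀ z * φ z :=
    Continuous.integrable_of_hasCompactSupport (by fun_prop) hφc.mul_left
  have ibp : ∀ w : Fin n → ℂ, ∫ z, u₀ z * fderiv ℝ φ z w = -∫ z, fderiv ℝ u₀ z w * φ z :=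
    fun w => integral_mul_fderiv_eq_neg_fderiv_mul_of_integrable (i1 w) (i2 w) i3
      (fun x _ => hu₀.differentiable (by simp) x) (fun x _ => hφ.differentiable (by simp) x)
  have e1 : ∫ z, v z * φ z = ∫ z, (fderiv ℝ u₀ z (Pi.single j 1) * φ z +
      Complex.I * (fderiv ℝ u₀ z (Pi.single j Complex.I) * φ z)) + z j / 2 * u₀ z * φ z := by
    refine integral_congr_ae ?_
    filter_upwards [hv] with z hz
    rw [hz]; ring
  have e2 : ∫ z, u z * (-(fderiv ℝ φ z (Pi.single j 1) +
        Complex.I * fderiv ℝ φ z (Pi.single j Complex.I)) + z j / 2 * φ z) =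
      ∫ z, (-(u₀ z * fderiv ℝ φ z (Pi.single j 1)) -
        Complex.I * (u₀ z * fderiv ℝ φ z (Pi.single j Complex.I))) + z j / 2 * u₀ z * φ z := by
    refine integral_congr_ae ?_
    filter_upwards [hu] with z hz
    rw [hz]; ring
  rw [e1, e2, integral_add (by exact (i1 _).add ((i1 _).const_mul _)) i4,
    integral_add (i1 _) (by exact (i1 _).const_mul _), integral_const_mul,
    integral_add (by exact (i2 _).neg.sub ((i2 _).const_mul _)) i4,
    integral_sub (by exact (i2 _).neg) (by exact (i2 _).const_mul _), integral_const_mul,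
    integral_neg, ibp, ibp]
  ring

theorem coeFn_monomialLift_PsiLp (m α : Fin n → ℕ) :
    monomialLift m (PsiLp m α) =ᵐ[volume] liftedPsiProd m α := by
  filter_upwards [coeFn_lift_toLp (isLiftWeight_monomialWeight m) (memLp_Psi m α)] with z hz
  rw [PsiLp, hz, monomialWeight, Psi_eq_prod, liftedPsiProd]
  push_cast
  rw [← Finset.prod_mul_distrib]
  refine Finset.prod_congr rfl fun i _ => ?_
  rw [liftedPsi, absMap]
  push_cast; ring

/-- The factor `r_j = |z_j|` of the shifted function and the phase `z_j / |z_j|` multiply to `z_j`,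
raising `z^m` to `z^{m+e_j}`. This is why the target needs a lift different from `U`. -/
theorem coeFn_phaseLift_PsiShiftLp (j : Fin n) (m α : Fin n → ℕ) :
    phaseLift j m (PsiShiftLp j m α) =ᵐ[volume]
      liftedPsiProd (m + Pi.single j 1) (α - Pi.single j 1) := by
  filter_upwards [coeFn_lift_toLp (isLiftWeight_phaseWeight j m)
    (memLp_coord_mul_Psi j m (m + Pi.single j 1) (α - Pi.single j 1)), ae_coord_ne_zero] with z hz h0
  have h1 : ∏ i, z i ^ (m + Pi.single j 1 : Fin n → ℕ) i = z j * ∏ i, z i ^ m i := by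
    simp only [Pi.add_apply, pow_add, Finset.prod_mul_distrib]
    have : ∏ i, z i ^ (Pi.single j 1 : Fin n → ℕ) i = z j := by
      rw [Finset.prod_eq_single j] <;> simp +contextual
    rw [this, mul_comm]
  have h2 : liftedPsiProd (m + Pi.single j 1) (α - Pi.single j 1) z =
      monomialWeight (m + Pi.single j 1) z *
        Psi (m + Pi.single j 1) (α - Pi.single j 1) (absMap z) := by
    rw [monomialWeight, Psi_eq_prod, liftedPsiProd]
    push_cast
    rw [← Finset.prod_mul_distrib]
    refine Finset.prod_congr rfl fun i _ => ?_
    rw [liftedPsi, absMap]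
    push_cast; ring
  rw [PsiShiftLp, hz, h2, phaseWeight, if_neg (h0 j), monomialWeight_eq, monomialWeight_eq, h1]
  have : (‖z j‖ : ℂ) ≠ 0 := by simpa using h0 j
  rw [show ((absMap z j : ℝ) : ℂ) = ‖z j‖ from rfl]
  field_simp

theorem isZbar_monomialLift_PsiLp (j : Fin n) (m α : Fin n → ℕ) :
    IsZbar j (monomialLift m (PsiLp m α))
      (-((Real.sqrt (2 * α j) : ℂ) • phaseLift j m (PsiShiftLp j m α))) := by
  refine isZbar_of_contDiff (contDiff_liftedPsiProd m α) (coeFn_monomialLift_PsiLp m α) ?_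
  filter_upwards [Lp.coeFn_neg ((Real.sqrt (2 * α j) : ℂ) • phaseLift j m (PsiShiftLp j m α)),
    Lp.coeFn_smul (Real.sqrt (2 * α j) : ℂ) (phaseLift j m (PsiShiftLp j m α)),
    coeFn_phaseLift_PsiShiftLp j m α] with z h1 h2 h3
  rw [h1, Pi.neg_apply, h2, Pi.smul_apply, h3, zbar_liftedPsiProd, smul_eq_mul]

/-! ### Closedness and uniqueness of `Z̄_j` -/

theorem exists_clm_integral_mul {φ : (Fin n → ℂ) → ℂ} (hφ : MemLp φ 2 volume) :
    ∃ ℓ : Lp ℂ 2 (volume : Measure (Fin n → ℂ)) →L[ℂ] ℂ, ∀ u, ℓ u = ∫ z, u z * φ z := by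
  have hc : MemLp (fun z => (starRingEnd ℂ) (φ z)) 2 volume := hφ.star
  refine ⟨innerSL ℂ hc.toLp, fun u => ?_⟩
  rw [innerSL_apply_apply, L2.inner_def]
  refine integral_congr_ae ?_
  filter_upwards [hc.coeFn_toLp] with z hz
  rw [hz, RCLike.inner_apply, Complex.conj_conj]

/-- For a fixed test function, both sides of the weak equation are continuous linear functionals on
`L²`. Hence the graph of `Z̄_j` is a closed linear subspace. -/
theorem exists_clm_isZbar (j : Fin n) {φ : (Fin n → ℂ) → ℂ} (hφ : ContDiff ℝ ∞ φ)
    (hφc : HasCompactSupport φ) :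
    ∃ ℓ ℓ' : Lp ℂ 2 (volume : Measure (Fin n → ℂ)) →L[ℂ] ℂ,
      (∀ v, ℓ v = ∫ z, v z * φ z) ∧
      ∀ u, ℓ' u = ∫ z, u z * (-(fderiv ℝ φ z (Pi.single j 1) +
        Complex.I * fderiv ℝ φ z (Pi.single j Complex.I)) + z j / 2 * φ z) := by
  have hcφ : Continuous φ := hφ.continuous
  have hdφ : Continuous (fderiv ℝ φ) := hφ.continuous_fderiv (by simp)
  obtain ⟨ℓ, hℓ⟩ := exists_clm_integral_mul (hcφ.memLp_of_hasCompactSupport hφc (p := 2))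
  have hs : HasCompactSupport fun z : Fin n → ℂ => -(fderiv ℝ φ z (Pi.single j 1) +
        Complex.I * fderiv ℝ φ z (Pi.single j Complex.I)) + z j / 2 * φ z :=
    (((hφc.fderiv_apply ℝ _).add (hφc.fderiv_apply ℝ _).mul_left).neg).add hφc.mul_left
  have hcs : Continuous fun z : Fin n → ℂ => -(fderiv ℝ φ z (Pi.single j 1) +
        Complex.I * fderiv ℝ φ z (Pi.single j Complex.I)) + z j / 2 * φ z := by fun_prop
  obtain ⟨ℓ', hℓ'⟩ := exists_clm_integral_mul (hcs.memLp_of_hasCompactSupport hs (p := 2))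
  exact ⟨ℓ, ℓ', hℓ, hℓ'⟩

theorem IsZbar.const_smul {j : Fin n} {u v : Lp ℂ 2 (volume : Measure (Fin n → ℂ))}
    (h : IsZbar j u v) (c : ℂ) : IsZbar j (c • u) (c • v) := by
  intro φ hφ hφc
  obtain ⟨ℓ, ℓ', hℓ, hℓ'⟩ := exists_clm_isZbar j hφ hφc
  rw [← hℓ, ← hℓ', map_smul, map_smul, hℓ, hℓ', h φ hφ hφc]

theorem isZbar_of_hasSum {ι : Type*} {j : Fin n}
    {u v : ι → Lp ℂ 2 (volume : Measure (Fin n → ℂ))}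
    {u₀ v₀ : Lp ℂ 2 (volume : Measure (Fin n → ℂ))} (h : ∀ i, IsZbar j (u i) (v i))
    (hu : HasSum u u₀) (hv : HasSum v v₀) : IsZbar j u₀ v₀ := by
  intro φ hφ hφc
  obtain ⟨ℓ, ℓ', hℓ, hℓ'⟩ := exists_clm_isZbar j hφ hφc
  have h1 := hv.mapL ℓ
  have h2 := hu.mapL ℓ'
  have h3 : (fun i => ℓ (v i)) = fun i => ℓ' (u i) := by
    ext i
    rw [hℓ, hℓ', h i φ hφ hφc]
  rw [h3] at h1
  rw [← hℓ, ← hℓ', h1.unique h2]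

/-- An `L²` function that integrates to zero against all test functions vanishes, and real-valued
ones suffice. This makes the value chosen in `zbar` canonical. -/
theorem IsZbar.unique {j : Fin n} {u v v' : Lp ℂ 2 (volume : Measure (Fin n → ℂ))}
    (h : IsZbar j u v) (h' : IsZbar j u v') : v = v' := by
  rw [← sub_eq_zero]
  have hloc : LocallyIntegrable (v - v' : Lp ℂ 2 (volume : Measure (Fin n → ℂ))) volume :=
    (Lp.memLp (v - v')).locallyIntegrable one_le_two
  refine (Lp.eq_zero_iff_ae_eq_zero).2
    (ae_eq_zero_of_integral_contDiff_smul_eq_zero hloc fun φ hφ hφc => ?_)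
  have hφ' : ContDiff ℝ ∞ fun z => (φ z : ℂ) := Complex.ofRealCLM.contDiff.comp hφ
  have hφc' : HasCompactSupport fun z => (φ z : ℂ) :=
    hφc.comp_left (g := fun t : ℝ => (t : ℂ)) Complex.ofReal_zero
  obtain ⟨ℓ, ℓ', hℓ, hℓ'⟩ := exists_clm_isZbar j hφ' hφc'
  have h0 : ℓ (v - v') = 0 := by
    rw [map_sub, hℓ, hℓ, h _ hφ' hφc', h' _ hφ' hφc', sub_self]
  rw [← h0, hℓ]
  refine integral_congr_ae (Filter.Eventually.of_forall fun z => ?_)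
  simp only [Complex.real_smul]
  ring

theorem zbar_eq {j : Fin n} {u v : Lp ℂ 2 (volume : Measure (Fin n → ℂ))}
    (h : IsZbar j u v) : zbar j u = v := by
  have hex : ∃ v, IsZbar j u v := ⟨v, h⟩
  rw [zbar, dif_pos hex]
  exact hex.choose_spec.unique h

/-! ### The intertwining relation between the two Riesz transforms -/

theorem summable_smul_of_orthonormal {ι E : Type*} [NormedAddCommGroup E] [InnerProductSpace ℂ E]
    [CompleteSpace E] {v : ι → E} (hv : Orthonormal ℂ v) {c : ι → ℂ}
    (hc : Summable fun i => ‖c i‖ ^ 2) : Summable fun i => c i • v i :=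
  (hv.orthogonalFamily.summable_iff_norm_sq_summable c).2 hc

theorem summable_norm_sq_mul_inner_PsiLp {m : Fin n → ℕ} (f : Lp ℂ 2 (muMeasure m))
    {c : (Fin n → ℕ) → ℝ} (hc : ∀ α, |c α| ≤ 1) :
    Summable fun α => ‖(c α : ℂ) * inner ℂ (PsiLp m α) f‖ ^ 2 := by
  refine Summable.of_nonneg_of_le (fun _ => by positivity) (fun α => ?_)
    ((orthonormal_PsiLp m).inner_products_summable f)
  rw [norm_mul, Complex.norm_real, Real.norm_eq_abs]
  gcongr
  exact mul_le_of_le_one_left (norm_nonneg _) (hc α)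

theorem abs_rieszCoeff_le_one (j : Fin n) (α : Fin n → ℕ) :
    |Real.sqrt (2 * α j) / Real.sqrt (2 * ((∑ i, α i : ℕ) : ℝ) + n)| ≤ 1 := by
  rw [abs_of_nonneg (by positivity)]
  refine div_le_one_of_le₀ (Real.sqrt_le_sqrt ?_) (Real.sqrt_nonneg _)
  have : (α j : ℝ) ≤ ((∑ i, α i : ℕ) : ℝ) := by
    exact_mod_cast Finset.single_le_sum (f := α) (fun i _ => Nat.zero_le _) (Finset.mem_univ j)
  have : (0 : ℝ) ≤ n := n.cast_nonneg
  linarith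

theorem abs_invSqrt_le_one (j : Fin n) (α : Fin n → ℕ) :
    |(Real.sqrt (2 * ((∑ i, α i : ℕ) : ℝ) + n))⁻¹| ≤ 1 := by
  rw [abs_of_nonneg (by positivity)]
  refine inv_le_one_of_one_le₀ (Real.one_le_sqrt.2 ?_)
  -- The existence of an index `j` excludes `n = 0`, for which the lowest eigenvalue would be `0`.
  have : (1 : ℝ) ≤ n := by exact_mod_cast Fin.pos j
  have : (0 : ℝ) ≤ ((∑ i, α i : ℕ) : ℝ) := Nat.cast_nonneg _
  linarith

/-- The terms of the series defining the Laguerre Riesz transform are summable in `L²(dμ_m)`. -/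
theorem summable_laguerreRiesz (j : Fin n) (m : Fin n → ℕ) (f : Lp ℂ 2 (muMeasure m)) :
    Summable fun α : Fin n → ℕ =>
      (((Real.sqrt (2 * α j) / Real.sqrt (2 * ((∑ i, α i : ℕ) : ℝ) + n) : ℝ) : ℂ) *
        inner ℂ (PsiLp m α) f) • PsiShiftLp j m α := by
  have hinj : Function.Injective fun α : Fin n → ℕ => α + Pi.single j 1 :=
    add_left_injective _
  have hsub : ∀ α : Fin n → ℕ, α + Pi.single j 1 - Pi.single j 1 = α := fun α => by
    ext i; simp
  -- Terms outside the range of `α ↦ α + e_j` have `α_j = 0` and vanish. On the range the shifted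
  -- family is orthonormal, so square-summable coefficients suffice.
  rw [← hinj.summable_iff]
  · refine summable_smul_of_orthonormal (v := fun α => PsiShiftLp j m (α + Pi.single j 1))
      (c := fun α => _ * _) ?_
      ((summable_norm_sq_mul_inner_PsiLp f (abs_rieszCoeff_le_one j)).comp_injective hinj)
    rw [orthonormal_iff_ite]
    intro α β
    rw [inner_PsiShiftLp, hsub, hsub]
  · intro α hα
    have h0 : α j = 0 := by
      by_contra h
      refine hα ⟨α - Pi.single j 1, ?_⟩
      ext i
      by_cases hi : i = j
      · subst hi
        simp only [Pi.add_apply, Pi.sub_apply, Pi.single_eq_same]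
        omega
      · simp [hi]
    simp [h0]

theorem laguerreRiesz_add (j : Fin n) (m : Fin n → ℕ) (f g : Lp ℂ 2 (muMeasure m)) :
    laguerreRiesz j m (f + g) = laguerreRiesz j m f + laguerreRiesz j m g := by
  simp only [laguerreRiesz, inner_add_right, mul_add, add_smul]
  exact (summable_laguerreRiesz j m f).tsum_add (summable_laguerreRiesz j m g)

theorem laguerreRiesz_smul (j : Fin n) (m : Fin n → ℕ) (c : ℂ) (f : Lp ℂ 2 (muMeasure m)) :
    laguerreRiesz j m (c • f) = c • laguerreRiesz j m f := by
  simp only [laguerreRiesz, inner_smul_right]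
  rw [← (summable_laguerreRiesz j m f).tsum_const_smul c]
  refine tsum_congr fun α => ?_
  rw [smul_smul]
  congr 1
  ring

/-- The unimodular constant `i^{|m|}` cancels in the rank-one projection. -/
theorem inner_smul_specialHermiteLp (m α : Fin n → ℕ) (f : Lp ℂ 2 (muMeasure m)) :
    inner ℂ (specialHermiteLp α (α + m)) (monomialLift m f) • specialHermiteLp α (α + m) =
      inner ℂ (PsiLp m α) f • monomialLift m (PsiLp m α) := by
  have hc : (starRingEnd ℂ) (∏ i, Complex.I ^ m i) * ∏ i, Complex.I ^ m i = 1 := by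
    rw [Complex.conj_mul', norm_prod]
    simp
  rw [specialHermiteLp_eq_lift, inner_smul_left, LinearIsometry.inner_map_map, smul_smul]
  congr 1
  linear_combination inner ℂ (PsiLp m α) f * hc

/-- By orthogonality, the double series over `(α, β)` reduces to the diagonal `β = α + m`. -/
theorem hasSum_invSqrtL_monomialLift (j : Fin n) (m : Fin n → ℕ) (f : Lp ℂ 2 (muMeasure m)) :
    HasSum (fun α : Fin n → ℕ => ((((Real.sqrt (2 * ((∑ i, α i : ℕ) : ℝ) + n))⁻¹ : ℝ) : ℂ) *
      inner ℂ (PsiLp m α) f) • monomialLift m (PsiLp m α)) (invSqrtL (monomialLift m f)) := by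
  have hs := summable_smul_of_orthonormal (orthonormal_PsiLp m)
    (summable_norm_sq_mul_inner_PsiLp f (abs_invSqrt_le_one j))
  have hs' := (monomialLift m).toContinuousLinearMap.summable hs
  have hinj : Function.Injective fun α : Fin n → ℕ => (α, α + m) :=
    fun α β h => (Prod.mk.inj h).1
  have e : invSqrtL (monomialLift m f) = ∑' α : Fin n → ℕ,
      ((((Real.sqrt (2 * ((∑ i, α i : ℕ) : ℝ) + n))⁻¹ : ℝ) : ℂ) *
      inner ℂ (PsiLp m α) f) • monomialLift m (PsiLp m α) := by
    rw [invSqrtL, ← hinj.tsum_eq]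
    · refine tsum_congr fun α => ?_
      rw [mul_smul, inner_smul_specialHermiteLp, ← mul_smul]
    · intro q hq
      by_contra h
      refine hq ?_
      have : q.2 ≠ q.1 + m := fun h' => h ⟨q.1, Prod.ext rfl h'.symm⟩
      simp only
      rw [inner_specialHermiteLp_monomialLift_eq_zero this, mul_zero, zero_smul]
  rw [e]
  refine Summable.hasSum (hs'.congr fun α => ?_)
  simp

theorem specialHermiteRiesz_monomialLift (j : Fin n) (m : Fin n → ℕ)
    (f : Lp ℂ 2 (muMeasure m)) :
    specialHermiteRiesz j (monomialLift m f) = -phaseLift j m (laguerreRiesz j m f) := by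
  refine zbar_eq (isZbar_of_hasSum (fun α => (isZbar_monomialLift_PsiLp j m α).const_smul _)
    (hasSum_invSqrtL_monomialLift j m f) ?_)
  have h := ((summable_laguerreRiesz j m f).hasSum.mapL
    (phaseLift j m).toContinuousLinearMap).neg
  refine Eq.mp (congrArg (HasSum · _) (funext fun α => ?_)) h
  simp only [LinearIsometry.coe_toContinuousLinearMap, map_smul, smul_neg, smul_smul]
  congr 2
  push_cast
  ring

theorem weightedIntegral_neg (p : ℝ) (m : Fin n → ℕ)
    (g : Lp ℂ 2 (volume : Measure (Fin n → ℂ))) :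
    weightedIntegral p m (-g : Lp ℂ 2 (volume : Measure (Fin n → ℂ))) =
      weightedIntegral p m g := by
  rw [weightedIntegral_congr (Lp.coeFn_neg g)]
  simp [weightedIntegral]

/-! ### Boundedness on `L^p` -/

theorem lintegral_rpow_eq_eLpNorm_rpow {p : ℝ≥0∞} (hp0 : p ≠ 0) (hp : p ≠ ⊤) {X : Type*}
    [MeasurableSpace X] (μ : Measure X) (f : X → ℂ) :
    ∫⁻ x, ‖f x‖ₑ ^ p.toReal ∂μ = eLpNorm f p μ ^ p.toReal := by
  rw [eLpNorm_eq_lintegral_rpow_enorm_toReal hp0 hp, ← ENNReal.rpow_mul,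
    one_div_mul_cancel (ENNReal.toReal_pos hp0 hp).ne', ENNReal.rpow_one]

theorem exists_memLp_two_of_simpleFunc {p : ℝ≥0∞} [Fact (1 ≤ p)] (hp : p ≠ ⊤) {X : Type*}
    [MeasurableSpace X] {μ : Measure X} (s : Lp.simpleFunc ℂ p μ) :
    ∃ f : Lp ℂ 2 μ, f =ᵐ[μ] (s : Lp ℂ p μ) := by
  have hp0 : p ≠ 0 := (zero_lt_one.trans_le (Fact.out : 1 ≤ p)).ne'
  have h1 : MemLp (Lp.simpleFunc.toSimpleFunc s) 2 μ :=
    (SimpleFunc.memLp_iff two_ne_zero ENNReal.ofNat_ne_top).2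
      ((SimpleFunc.memLp_iff hp0 hp).1 (Lp.simpleFunc.memLp s))
  exact ⟨h1.toLp, h1.coeFn_toLp.trans (Lp.simpleFunc.toSimpleFunc_eq_toFun s)⟩

/-- A linear operator on `L²` extends from `L² ∩ L^p` to a bounded operator on `L^p` if it is
bounded there in the `L^p` norm. -/
theorem exists_clm_of_eLpNorm_le {p : ℝ≥0∞} [Fact (1 ≤ p)] (hp : p ≠ ⊤) {X : Type*}
    [MeasurableSpace X] {μ : Measure X} (T : Lp ℂ 2 μ →ₗ[ℂ] Lp ℂ 2 μ) (C : ℝ≥0)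
    (hT : ∀ f : Lp ℂ 2 μ, MemLp f p μ → eLpNorm (T f) p μ ≤ C * eLpNorm f p μ) :
    ∃ S : Lp ℂ p μ →L[ℂ] Lp ℂ p μ, ∀ (f : Lp ℂ 2 μ) (hf : MemLp f p μ),
      S hf.toLp =ᵐ[μ] T f := by
  let D : Submodule ℂ (Lp ℂ 2 μ) :=
    { carrier := {f | MemLp f p μ}
      add_mem' := fun {f g} hf hg => (hf.add hg).ae_eq (Lp.coeFn_add f g).symm
      zero_mem' := MemLp.ae_eq (Lp.coeFn_zero ℂ 2 μ).symm MemLp.zero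
      smul_mem' := fun c f hf => (hf.const_smul c).ae_eq (Lp.coeFn_smul c f).symm }
  have hD : ∀ x : D, MemLp (x : Lp ℂ 2 μ) p μ := fun x => x.2
  have hTD : ∀ x : D, MemLp (T x) p μ := fun x =>
    ⟨Lp.aestronglyMeasurable _, (hT x (hD x)).trans_lt
      (ENNReal.mul_lt_top ENNReal.coe_lt_top (hD x).2)⟩
  let e : D →ₗ[ℂ] Lp ℂ p μ :=
    { toFun := fun x => (hD x).toLp
      map_add' := fun x y => by
        rw [← MemLp.toLp_add]
        exact MemLp.toLp_congr _ _ (Lp.coeFn_add _ _)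
      map_smul' := fun c x => by
        rw [RingHom.id_apply, ← MemLp.toLp_const_smul]
        exact MemLp.toLp_congr _ _ (Lp.coeFn_smul _ _) }
  let F : D →ₗ[ℂ] Lp ℂ p μ :=
    { toFun := fun x => (hTD x).toLp
      map_add' := fun x y => by
        rw [← MemLp.toLp_add]
        refine MemLp.toLp_congr _ _ ?_
        rw [Submodule.coe_add, map_add]
        exact Lp.coeFn_add _ _
      map_smul' := fun c x => by
        rw [RingHom.id_apply, ← MemLp.toLp_const_smul]
        refine MemLp.toLp_congr _ _ ?_
        rw [Submodule.coe_smul, map_smul]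
        exact Lp.coeFn_smul _ _ }
  -- For `p < ∞`, integrable simple functions are dense in `L^p`. They have support of finite
  -- measure, hence lie in `L²` as well.
  have hdense : DenseRange e := by
    refine Dense.mono ?_ (Lp.simpleFunc.denseRange (E := ℂ) (μ := μ) hp)
    rintro _ ⟨s, rfl⟩
    obtain ⟨f, hf⟩ := exists_memLp_two_of_simpleFunc hp s
    have hfp : MemLp f p μ := (Lp.memLp (s : Lp ℂ p μ)).ae_eq hf.symm
    exact ⟨⟨f, hfp⟩, Lp.ext (hfp.coeFn_toLp.trans hf)⟩
  have hnorm : ∃ C : ℝ, ∀ x, ‖F x‖ ≤ C * ‖e x‖ := by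
    refine ⟨C, fun x => ?_⟩
    change ‖(hTD x).toLp‖ ≤ C * ‖(hD x).toLp‖
    rw [Lp.norm_toLp, Lp.norm_toLp, ← ENNReal.coe_toReal, ← ENNReal.toReal_mul]
    exact ENNReal.toReal_mono (ENNReal.mul_lt_top ENNReal.coe_lt_top (hD x).2).ne (hT x (hD x))
  refine ⟨F.extendOfNorm e, fun f hf => ?_⟩
  have h := LinearMap.extendOfNorm_eq hdense hnorm ⟨f, hf⟩
  have he : e ⟨f, hf⟩ = hf.toLp := rfl
  rw [← he, h]
  exact (hTD ⟨f, hf⟩).coeFn_toLp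

/-- The inequality is asked of every `f` in `L²`, so that no `L^p` condition has to be carried
through the lift. When `f` is not in `L^p` the integral on the right is infinite. -/
theorem laguerreRieszBounded_iff (p : ℝ≥0∞) [Fact (1 ≤ p)] (hp : p ≠ ⊤) (j : Fin n)
    (m : Fin n → ℕ) :
    LaguerreRieszBounded p j m ↔ ∃ C : ℝ≥0, ∀ f : Lp ℂ 2 (muMeasure m),
      ∫⁻ r, ‖laguerreRiesz j m f r‖ₑ ^ p.toReal ∂muMeasure m ≤
        C * ∫⁻ r, ‖f r‖ₑ ^ p.toReal ∂muMeasure m := by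
  have hp0 : p ≠ 0 := (zero_lt_one.trans_le (Fact.out : 1 ≤ p)).ne'
  have hq : 0 < p.toReal := ENNReal.toReal_pos hp0 hp
  simp only [lintegral_rpow_eq_eLpNorm_rpow hp0 hp]
  constructor
  · rintro ⟨S, hS⟩
    -- The summand `1` makes the constant positive even when `S = 0`; otherwise the right side would
    -- be `0 * ⊤ = 0` for `f` outside `L^p`.
    refine ⟨‖S‖₊ ^ p.toReal + 1, fun f => ?_⟩
    by_cases hf : MemLp f p (muMeasure m)
    · have h1 : eLpNorm (laguerreRiesz j m f) p (muMeasure m) ≤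
          ‖S‖₊ * eLpNorm f p (muMeasure m) := by
        have h2 := S.le_opENorm hf.toLp
        rw [Lp.enorm_def, Lp.enorm_def, eLpNorm_congr_ae (hS f hf),
          eLpNorm_congr_ae hf.coeFn_toLp] at h2
        exact h2
      calc _ ≤ (‖S‖₊ * eLpNorm f p (muMeasure m)) ^ p.toReal := by gcongr
        _ = ((‖S‖₊ ^ p.toReal : ℝ≥0) : ℝ≥0∞) * eLpNorm f p (muMeasure m) ^ p.toReal := by
          rw [ENNReal.mul_rpow_of_nonneg _ _ hq.le, ENNReal.coe_rpow_of_nonneg _ hq.le]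
        _ ≤ _ := by gcongr; exact le_self_add
    · have : eLpNorm f p (muMeasure m) = ⊤ := by
        by_contra h
        exact hf ⟨Lp.aestronglyMeasurable f, lt_top_iff_ne_top.2 h⟩
      rw [this, ENNReal.top_rpow_of_pos hq, ENNReal.mul_top (by simp)]
      exact le_top
  · rintro ⟨C, hC⟩
    let T : Lp ℂ 2 (muMeasure m) →ₗ[ℂ] Lp ℂ 2 (muMeasure m) :=
      { toFun := laguerreRiesz j m
        map_add' := laguerreRiesz_add j m
        map_smul' := laguerreRiesz_smul j m }
    refine exists_clm_of_eLpNorm_le hp T (C ^ (1 / p.toReal)) fun f _ => ?_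
    rw [← ENNReal.rpow_le_rpow_iff hq, ENNReal.mul_rpow_of_nonneg _ _ hq.le,
      ENNReal.coe_rpow_of_nonneg _ (by positivity), ← ENNReal.rpow_mul,
      one_div_mul_cancel hq.ne', ENNReal.rpow_one]
    exact hC f

end LaguerreRiesz

end

/-! ### Transfer of the inequality between the two sides -/

theorem theorem4p2 {n : ℕ} (p : ℝ≥0∞) [Fact (1 ≤ p)] (hp : p ≠ ⊤) (j : Fin n) (m : Fin n → ℕ) :
    LaguerreRiesz.LaguerreRieszBounded p j m ↔
      ∃ C : ℝ≥0, ∀ g : Lp ℂ 2 (volume : Measure (Fin n → ℂ)), LaguerreRiesz.IsHomogeneous m g →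
        LaguerreRiesz.weightedIntegral p.toReal m (LaguerreRiesz.specialHermiteRiesz j g) ≤
          C * LaguerreRiesz.weightedIntegral p.toReal m g := by
  have hq : 0 < p.toReal :=
    ENNReal.toReal_pos (zero_lt_one.trans_le (Fact.out : 1 ≤ p)).ne' hp
  rw [LaguerreRiesz.laguerreRieszBounded_iff p hp j m]
  refine exists_congr fun C => ?_
  -- The lifting constant is positive and finite, so it cancels from both sides and the same `C`
  -- serves in both directions.
  have hK : ENNReal.ofReal ((Real.sqrt (2 * Real.pi) ^ (2 - p.toReal)) ^ n) ≠ 0 := by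
    rw [Ne, ENNReal.ofReal_eq_zero, not_le]; positivity
  have key : ∀ f : Lp ℂ 2 (LaguerreRiesz.muMeasure m),
      LaguerreRiesz.weightedIntegral p.toReal m
        (LaguerreRiesz.specialHermiteRiesz j (LaguerreRiesz.monomialLift m f)) ≤
          C * LaguerreRiesz.weightedIntegral p.toReal m (LaguerreRiesz.monomialLift m f) ↔
      ∫⁻ r, ‖LaguerreRiesz.laguerreRiesz j m f r‖ₑ ^ p.toReal ∂LaguerreRiesz.muMeasure m ≤
        C * ∫⁻ r, ‖f r‖ₑ ^ p.toReal ∂LaguerreRiesz.muMeasure m := by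
    intro f
    rw [LaguerreRiesz.specialHermiteRiesz_monomialLift, LaguerreRiesz.weightedIntegral_neg,
      LaguerreRiesz.weightedIntegral_lift hq, LaguerreRiesz.weightedIntegral_lift hq,
      mul_left_comm, ENNReal.mul_le_mul_iff_right hK ENNReal.ofReal_ne_top]
  constructor
  · intro h g hg
    obtain ⟨f, rfl⟩ := LaguerreRiesz.exists_monomialLift_eq hg
    exact (key f).2 (h f)
  · intro h f
    exact (key f).1 (h _ (LaguerreRiesz.isHomogeneous_monomialLift m f))
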